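/- Let $G$ be a finite simple graph on the vertex set $V$, let $K$ be a field, and let $S = K[V]$ be the polynomial ring whose variables are the vertices of $G$, with its standard $\mathbb{N}^V$-grading. Let $I(G) = (uv : \{u,v\} \in E(G)) \subseteq S$ be the edge ideal of $G$. For $\tau \in \mathbb{N}^V$ let $\beta_{i,\tau}(S/I(G))$ be the $i$th $\mathbb{N}^V$-graded Betti number of degree $\tau$, i.e. the number of copies of $S(-\tau)$ in the $i$th term of a minimal $\mathbb{N}^V$-graded free resolution of $S/I(G)$ (with finitely generated terms); such a resolution exists, and the statement below holds for every one of them. Identify a subset $\sigma \subseteq V$ with its $(0,1)$-vector in $\mathbb{N}^V$, and let $G_\sigma$ be the induced subgraph of $G$ on $\sigma$. For $c \ge 2$, a graph is complete $c$-partite if its vertex set can be partitioned into $c$ nonempty classes such that two vertices are adjacent if and only if they lie in different classes; complete bipartite means complete $2$-partite. For a finite simple graph $H$, let $c(H)$ be the largest $c \ge 2$ such that $H$ contains a complete $c$-partite graph as a spanning subgraph, and put $c(H) = 1$ if $H$ contains no complete bipartite graph as a spanning subgraph. **Proposition 5.1.** Let $i \ge 1$ be an integer and let $\sigma \subseteq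 V$ with $|\sigma| = i+1$. Then $$\beta_{i,\sigma}(S/I(G)) = c(G_\sigma) - 1.$$ In particular, for such $i$ and $\sigma$, $\beta_{i,\sigma}(S/I(G)) \ne 0$ if and only if $G_\sigma$ contains a complete bipartite graph as a spanning subgraph. -/

import Mathlib

open MvPolynomial

noncomputable section

namespace EdgeIdealBetti

/-! ### Graphs -/

/-- `H` is a complete `c`-partite graph: its vertex set is partitioned into `c` nonempty classes
(the fibres of a surjection `f` onto `Fin c`), and two vertices are adjacent iff they lie in
different classes. -/
def IsCompletePartite {W : Type*} (H : SimpleGraph W) (c : ℕ) : Prop :=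
  ∃ f : W → Fin c, Function.Surjective f ∧ ∀ u v, H.Adj u v ↔ f u ≠ f v

/-- `G` contains a complete `c`-partite graph as a spanning subgraph. (Subgraphs of `G` with the
same vertex set are the graphs `H ≤ G` on the vertex type of `G`.) -/
def HasSpanningCompletePartite {W : Type*} (G : SimpleGraph W) (c : ℕ) : Prop :=
  ∃ H : SimpleGraph W, H ≤ G ∧ IsCompletePartite H c

open Classical in
/-- The invariant `c(G)`: the largest `c ≥ 2` such that `G` contains a complete `c`-partite graph
as a spanning subgraph, and `1` if `G` contains no complete bipartite spanning subgraph. -/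
def partiteNumber {W : Type*} (G : SimpleGraph W) : ℕ :=
  if HasSpanningCompletePartite G 2 then
    sSup {c : ℕ | 2 ≤ c ∧ HasSpanningCompletePartite G c}
  else 1

/-- The edge ideal `I(G) = (uv : {u, v} ∈ E(G))` in the polynomial ring `K[V]`. -/
def edgeIdeal {V : Type*} (K : Type*) [Field K] (G : SimpleGraph V) :
    Ideal (MvPolynomial V K) :=
  Ideal.span {p | ∃ u v : V, G.Adj u v ∧ p = X u * X v}

/-- The `(0,1)`-vector of a set of vertices. -/
def zeroOneVector {V : Type*} (σ : Finset V) : V →₀ ℕ :=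
  ∑ v ∈ σ, Finsupp.single v 1

/-! ### Multigraded modules and minimal free resolutions -/

/-- The graded piece of degree `τ` of `K[V] ⧸ I` (for `I` a monomial ideal): the image of the
line spanned by the monomial of exponent `τ`. -/
def quotientPiece {V K : Type*} [Field K] (I : Ideal (MvPolynomial V K)) (τ : V →₀ ℕ) :
    Submodule K (MvPolynomial V K ⧸ I) :=
  (Submodule.span K {monomial τ (1 : K)}).map (Ideal.Quotient.mkₐ K I).toLinearMap

/-- `x` lies in the graded piece of degree `τ` of the free module `⨁ b, S(-deg b)`, where
`S = K[V]`: as `S(-δ)` has the degree `τ` piece `S_{τ - δ}`, this says that the coordinate of `x`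
at `b` involves no monomial other than the one of exponent `τ - deg b`. -/
def IsHomogeneousElem {V K ι : Type*} [Field K] (deg : ι → V →₀ ℕ) (τ : V →₀ ℕ)
    (x : ι →₀ MvPolynomial V K) : Prop :=
  ∀ b, ∀ e ∈ (x b).support, e + deg b = τ

/-- A minimal `ℕ^V`-graded free resolution (with finitely generated terms)
`⋯ → F₂ → F₁ → F₀ → M → 0`, `F i = ⨁ b : ι i, S(-deg i b)`, of the `ℕ^V`-graded module `M` over
`S = K[V]` whose graded pieces are `piece τ`. -/
structure MinimalFreeResolution {V K M : Type*} [Field K] [AddCommGroup M] [Module K M]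
    [Module (MvPolynomial V K) M] (piece : (V →₀ ℕ) → Submodule K M) where
  /-- the index set of the homogeneous basis of the `i`th free module -/
  ι : ℕ → Type
  finite_ι : ∀ i, Finite (ι i)
  /-- the degrees of the basis elements -/
  deg : ∀ i, ι i → V →₀ ℕ
  /-- the differentials -/
  d : ∀ i, (ι (i + 1) →₀ MvPolynomial V K) →ₗ[MvPolynomial V K] (ι i →₀ MvPolynomial V K)
  /-- the augmentation -/
  ε : (ι 0 →₀ MvPolynomial V K) →ₗ[MvPolynomial V K] M
  /-- the differentials are homogeneous of degree `0` -/
  d_homogeneous : ∀ i τ x, IsHomogeneousElem (deg (i + 1)) τ x →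
    IsHomogeneousElem (deg i) τ (d i x)
  /-- the augmentation is homogeneous of degree `0` -/
  ε_homogeneous : ∀ τ x, IsHomogeneousElem (deg 0) τ x → ε x ∈ piece τ
  exact_d : ∀ i, Function.Exact (d (i + 1)) (d i)
  exact_ε : Function.Exact (d 0) ε
  surjective_ε : Function.Surjective ε
  /-- minimality: the image of `F (i + 1) → F i` lies in `𝔪 F i`, `𝔪` the ideal of the variables -/
  minimal : ∀ i x b, d i x b ∈ Ideal.span (Set.range (X : V → MvPolynomial V K))

/-- The number of copies of `S(-σ)` in the `i`th term of a minimal free resolution of `M`, that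
is, the multigraded Betti number `β_{i,σ}(M)`. -/
def MinimalFreeResolution.betti {V K M : Type*} [Field K] [AddCommGroup M] [Module K M]
    [Module (MvPolynomial V K) M] {piece : (V →₀ ℕ) → Submodule K M}
    (F : MinimalFreeResolution piece) (i : ℕ) (σ : V →₀ ℕ) : ℕ :=
  Nat.card {b : F.ι i // F.deg i b = σ}

end EdgeIdealBetti

end

/-!
The Betti number `β_{i,σ}(S/I)` is the dimension of the degree `σ` part of `Tor_i(S/I, K)`, and
`Tor` can be computed by the Koszul complex. In degree `σ` with `|σ| = i + 1` the Koszul complex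
with coefficients in `S/I(G)` has in homological degree `i + 1` dimension one, in degree `i` a basis
indexed by the vertices of `σ`, and in degree `i - 1` a basis indexed by the pairs of distinct
vertices of `σ` not joined in `G`. Up to signs, the cycles of degree `i` are the functions on `σ`
that agree at nonadjacent vertices, and the boundaries are the constants. So `β_{i,σ} + 1` is the
number of components of the complement of `G_σ` (`koszulDim_edgePiece`). A spanning complete
`c`-partite subgraph of `G_σ` amounts to a surjection from these components onto the `c` classes, so
their number is `c(G_σ)` (`partiteNumber_eq`).

The comparison of Betti numbers and Koszul homology avoids `Tor`. For a homogeneous map `f` from a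
graded free module `F` with `ker f ⊆ 𝔪 F`, the Koszul homology of the image of `f` in degree `j + 1`
and of its kernel in degree `j` have the same dimension, since Koszul homology of `F` vanishes in
positive degrees (`exists_koszulD_eq`, `koszulDim_map_freePiece_succ`). Walking down a minimal
resolution, the `i`th Koszul homology of `S/I` becomes the `0`th one of the `i`th syzygy module,
that is, of the `i`th free module, and this counts the basis elements of degree `σ`
(`MinimalFreeResolution.koszulDim_eq_betti`). Only squarefree degrees occur, so a module enters
through the family of its pieces indexed by finite sets of vertices.

Minimal resolutions exist (`nonempty_minimalFreeResolution`) since a graded submodule of a graded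
free module of finite rank has a homogeneous generating family of least size, and the relations
between such generators have no unit coefficients.
-/

open MvPolynomial

noncomputable section

namespace EdgeIdealBetti

/-! ### Dimensions of subquotients -/

section Subquotients

variable {K X Y Y' : Type*} [Field K] [AddCommGroup X] [Module K X] [AddCommGroup Y] [Module K Y]
  [AddCommGroup Y'] [Module K Y']

/-- The dimension of the subquotient `Z / (Z ∩ B)`. -/
def quotDim (Z B : Submodule K X) : ℕ := Module.finrank K (Z ⧸ B.submoduleOf Z)

theorem quotDim_congr {Z B B' : Submodule K X} (h : ∀ x ∈ Z, x ∈ B ↔ x ∈ B') :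
    quotDim Z B = quotDim Z B' := by
  have : B.submoduleOf Z = B'.submoduleOf Z := by
    ext ⟨x, hx⟩
    simpa [Submodule.submoduleOf] using h x hx
  rw [quotDim, quotDim, this]

theorem quotDim_comap (p : X →ₗ[K] Y) {W : Submodule K X} {Z B : Submodule K Y}
    (h₁ : W.map p ≤ Z) (h₂ : Z ≤ W.map p ⊔ B) : quotDim W (B.comap p) = quotDim Z B := by
  let q : W →ₗ[K] Z := p.restrict fun x hx => h₁ (Submodule.mem_map_of_mem hx)
  let r : W →ₗ[K] (Z ⧸ B.submoduleOf Z) := (B.submoduleOf Z).mkQ ∘ₗ q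
  have hr : Function.Surjective r := by
    intro z
    obtain ⟨⟨z, hz⟩, rfl⟩ := Submodule.Quotient.mk_surjective _ z
    obtain ⟨_, ⟨w, hw, rfl⟩, b, hb, rfl⟩ := Submodule.mem_sup.1 (h₂ hz)
    refine ⟨⟨w, hw⟩, ?_⟩
    change Submodule.Quotient.mk _ = Submodule.Quotient.mk _
    rw [Submodule.Quotient.eq]
    simp only [Submodule.submoduleOf, Submodule.mem_comap]
    have : p w - (p w + b) ∈ B := by simpa using hb
    exact this
  have hk : LinearMap.ker r = (B.comap p).submoduleOf W := by
    ext ⟨x, hx⟩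
    simp only [r, LinearMap.mem_ker, LinearMap.comp_apply, Submodule.mkQ_apply,
      Submodule.Quotient.mk_eq_zero]
    rfl
  rw [quotDim, ← hk]
  exact (r.quotKerEquivOfSurjective hr).finrank_eq

/-- Two subquotients onto which the same space `W` surjects, with the same kernel, have the same
dimension. -/
theorem quotDim_eq_of_maps (p : X →ₗ[K] Y) (q : X →ₗ[K] Y') {W : Submodule K X}
    {Z B : Submodule K Y} {Z' B' : Submodule K Y'}
    (hp₁ : W.map p ≤ Z) (hp₂ : Z ≤ W.map p ⊔ B) (hq₁ : W.map q ≤ Z') (hq₂ : Z' ≤ W.map q ⊔ B')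
    (h : ∀ x ∈ W, p x ∈ B ↔ q x ∈ B') : quotDim Z B = quotDim Z' B' := by
  rw [← quotDim_comap p hp₁ hp₂, ← quotDim_comap q hq₁ hq₂]
  exact quotDim_congr h

/-- Dimension shifting. The submodules `C₂, C₁, C₀` are three consecutive terms of a complex `C` in
`X`, and `f` maps `C` onto a complex in `Y`; the kernel has the terms `C ⊓ ker f`. If `C` is exact
at `C₁` and the cycles of the kernel at `C₀` are boundaries in `C`, then the connecting map from the
homology of the image to the homology of the kernel is bijective: the elements `x` of `C₁` with
`∂ (f x) = 0` map onto both, by `f` and by `∂`, with the same kernel. -/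
theorem quotDim_connecting (dX : X →ₗ[K] X) (dY : Y →ₗ[K] Y) (f : X →ₗ[K] Y)
    (hf : ∀ x, f (dX x) = dY (f x)) (hd : ∀ x, dX (dX x) = 0) (C₂ C₁ C₀ : Submodule K X)
    (h₂ : C₂.map dX ≤ C₁) (h₁ : C₁.map dX ≤ C₀)
    (hex₁ : C₁ ⊓ LinearMap.ker dX ≤ C₂.map dX)
    (hex₀ : (C₀ ⊓ LinearMap.ker f) ⊓ LinearMap.ker dX ≤ C₁.map dX) :
    quotDim (C₁.map f ⊓ LinearMap.ker dY) ((C₂.map f).map dY) =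
      quotDim ((C₀ ⊓ LinearMap.ker f) ⊓ LinearMap.ker dX)
        ((C₁ ⊓ LinearMap.ker f).map dX) := by
  refine quotDim_eq_of_maps f dX (W := C₁ ⊓ LinearMap.ker (dY ∘ₗ f)) ?_ ?_ ?_ ?_ ?_
  · rintro _ ⟨x, ⟨hx, hx'⟩, rfl⟩
    exact ⟨Submodule.mem_map_of_mem hx, hx'⟩
  · rintro _ ⟨⟨x, hx, rfl⟩, hx'⟩
    exact Submodule.mem_sup_left ⟨x, ⟨hx, hx'⟩, rfl⟩
  · rintro _ ⟨x, ⟨hx, hx'⟩, rfl⟩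
    exact ⟨⟨h₁ (Submodule.mem_map_of_mem hx), by
      simpa [hf] using hx'⟩, by simpa using hd x⟩
  · rintro z hz
    obtain ⟨x, hx, rfl⟩ := hex₀ hz
    refine Submodule.mem_sup_left ⟨x, ⟨hx, ?_⟩, rfl⟩
    have := hz.1.2
    simpa [hf] using this
  · rintro x ⟨hx, hx'⟩
    constructor
    · rintro ⟨_, ⟨y, hy, rfl⟩, hxy⟩
      refine ⟨x - dX y, ⟨sub_mem hx (h₂ (Submodule.mem_map_of_mem hy)), ?_⟩, ?_⟩
      · simp [hf, hxy]
      · simp [hd]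
    · rintro ⟨n, ⟨hn, hn'⟩, hxn⟩
      obtain ⟨y, hy, hxy⟩ := hex₁ (show x - n ∈ C₁ ⊓ LinearMap.ker dX from
        ⟨sub_mem hx hn, by simp [hxn]⟩)
      refine ⟨f y, Submodule.mem_map_of_mem hy, ?_⟩
      have h0 : f n = 0 := hn'
      rw [← hf, hxy, map_sub, h0, sub_zero]

end Subquotients

/-! ### The Koszul complex in a squarefree degree -/

section Chains

variable {V K N N' : Type*} [DecidableEq V] [Field K] [AddCommGroup N] [Module K N]
  [AddCommGroup N'] [Module K N']

/-- The Koszul chains of homological degree `j` and internal degree `σ`, where `P B` is the piece of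
`N` of squarefree degree `B`: the coefficient of `e_A`, which has degree `A`, lies in
`P (σ \ A)`. -/
def koszulChain (P : Finset V → Submodule K N) (σ : Finset V) (j : ℕ) :
    Submodule K (Finset V → N) :=
  Submodule.pi Set.univ fun A => if A ⊆ σ ∧ A.card = j then P (σ \ A) else ⊥

theorem mem_koszulChain {P : Finset V → Submodule K N} {σ : Finset V} {j : ℕ}
    {x : Finset V → N} : x ∈ koszulChain P σ j ↔
      (∀ A, A ⊆ σ → A.card = j → x A ∈ P (σ \ A)) ∧
      (∀ A, ¬(A ⊆ σ ∧ A.card = j) → x A = 0) := by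
  simp only [koszulChain, Submodule.mem_pi, Set.mem_univ, true_imp_iff]
  constructor
  · intro h
    refine ⟨fun A h₁ h₂ => by simpa [h₁, h₂] using h A, fun A hA => ?_⟩
    have := h A
    rwa [if_neg hA, Submodule.mem_bot] at this
  · rintro ⟨h₁, h₂⟩ A
    split_ifs with h
    · exact h₁ A h.1 h.2
    · exact h₂ A h

theorem koszulChain_inf_ker (P : Finset V → Submodule K N) (σ : Finset V) (j : ℕ)
    (f : N →ₗ[K] N') :
    koszulChain (fun B => P B ⊓ LinearMap.ker f) σ j =
      koszulChain P σ j ⊓ LinearMap.ker (f.compLeft (Finset V)) := by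
  ext x
  simp only [Submodule.mem_inf, mem_koszulChain, LinearMap.mem_ker]
  constructor
  · rintro ⟨h₁, h₂⟩
    refine ⟨⟨fun A h h' => (h₁ A h h').1, h₂⟩, ?_⟩
    ext A
    by_cases hA : A ⊆ σ ∧ A.card = j
    · exact (h₁ A hA.1 hA.2).2
    · exact (congrArg f (h₂ A hA)).trans (map_zero f)
  · rintro ⟨⟨h₁, h₂⟩, h₃⟩
    exact ⟨fun A h h' => ⟨h₁ A h h', congrFun h₃ A⟩, h₂⟩

theorem koszulChain_map (P : Finset V → Submodule K N) (σ : Finset V) (j : ℕ) (f : N →ₗ[K] N') :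
    koszulChain (fun B => (P B).map f) σ j = (koszulChain P σ j).map (f.compLeft (Finset V)) := by
  classical
  ext y
  constructor
  · intro hy
    rw [mem_koszulChain] at hy
    have : ∀ A, ∃ x, f x = y A ∧ (A ⊆ σ → A.card = j → x ∈ P (σ \ A)) ∧
        (¬(A ⊆ σ ∧ A.card = j) → x = 0) := by
      intro A
      by_cases hA : A ⊆ σ ∧ A.card = j
      · obtain ⟨x, hx, hxy⟩ := hy.1 A hA.1 hA.2
        exact ⟨x, hxy, fun _ _ => hx, fun h => absurd hA h⟩
      · exact ⟨0, by simp [hy.2 A hA], fun h h' => absurd ⟨h, h'⟩ hA, fun _ => rfl⟩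
    choose x h₁ h₂ h₃ using this
    exact ⟨x, mem_koszulChain.2 ⟨h₂, h₃⟩, funext h₁⟩
  · rintro ⟨x, hx, rfl⟩
    have hx := mem_koszulChain.1 hx
    rw [mem_koszulChain]
    refine ⟨fun A h h' => Submodule.mem_map_of_mem (hx.1 A h h'), fun A hA => ?_⟩
    exact (congrArg f (hx.2 A hA)).trans (map_zero f)

end Chains

section Koszul

variable {V K N N' : Type*} [LinearOrder V] [Field K]
  [AddCommGroup N] [Module K N] [Module (MvPolynomial V K) N] [IsScalarTower K (MvPolynomial V K) N]
  [AddCommGroup N'] [Module K N'] [Module (MvPolynomial V K) N']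
  [IsScalarTower K (MvPolynomial V K) N']

/-- The sign of `e_v ∧ e_A` relative to the sorted wedge product `e_{A ∪ {v}}`. -/
def koszulSign (v : V) (A : Finset V) : ℤ := (-1) ^ (A.filter (· < v)).card

theorem koszulSign_mul_self (v : V) (A : Finset V) : koszulSign v A * koszulSign v A = 1 := by
  rw [koszulSign, ← mul_pow]
  simp

theorem koszulSign_insert_of_lt {u v : V} {A : Finset V} (h : u < v) (hu : u ∉ A) :
    koszulSign v (insert u A) = -koszulSign v A ∧ koszulSign u (insert v A) = koszulSign u A := by
  constructor
  · rw [koszulSign, koszulSign, Finset.filter_insert, if_pos h,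
      Finset.card_insert_of_notMem, pow_succ]
    · ring
    · simp [hu]
  · rw [koszulSign, koszulSign, Finset.filter_insert, if_neg h.le.not_gt]

theorem koszulSign_swap {u v : V} {A : Finset V} (h : u ≠ v) (hu : u ∉ A) (hv : v ∉ A) :
    koszulSign u (insert v A) * koszulSign v A =
      -(koszulSign v (insert u A) * koszulSign u A) := by
  rcases h.lt_or_gt with h | h
  · obtain ⟨h₁, h₂⟩ := koszulSign_insert_of_lt h hu
    rw [h₁, h₂]
    ring
  · obtain ⟨h₁, h₂⟩ := koszulSign_insert_of_lt h hv
    rw [h₁, h₂]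
    ring

variable (K N) in
/-- The Koszul differential on the variables in `σ` with coefficients in `N`. A chain
`∑ A, x A ⊗ e_A` is encoded as the function `x` on finite sets of vertices. -/
def koszulD (σ : Finset V) : (Finset V → N) →ₗ[K] (Finset V → N) where
  toFun x A := ∑ v ∈ σ \ A, koszulSign v A • ((X v : MvPolynomial V K) • x (insert v A))
  map_add' x y := by
    ext A
    simp [smul_add, Finset.sum_add_distrib]
  map_smul' c x := by
    ext A
    simp only [Pi.smul_apply, RingHom.id_apply, Finset.smul_sum]
    refine Finset.sum_congr rfl fun v _ => ?_
    rw [smul_comm c, smul_comm c]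

theorem koszulD_apply (σ : Finset V) (x : Finset V → N) (A : Finset V) :
    koszulD K N σ x A =
      ∑ v ∈ σ \ A, koszulSign v A • ((X v : MvPolynomial V K) • x (insert v A)) := rfl

theorem koszulD_koszulD (σ : Finset V) (x : Finset V → N) :
    koszulD K N σ (koszulD K N σ x) = 0 := by
  ext A
  simp only [koszulD_apply, Finset.smul_sum, Pi.zero_apply]
  rw [Finset.sum_sigma']
  refine Finset.sum_involution (fun p _ => ⟨p.2, p.1⟩) ?_ ?_ ?_ ?_
  · rintro ⟨u, v⟩ h
    simp only [Finset.mem_sigma, Finset.mem_sdiff, Finset.mem_insert, not_or] at h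
    obtain ⟨⟨hu, huA⟩, hv, hvu, hvA⟩ := h
    simp only
    rw [smul_comm (X u : MvPolynomial V K) (koszulSign v (insert u A)),
      smul_comm (X v : MvPolynomial V K) (koszulSign u (insert v A)), smul_smul, smul_smul,
      smul_smul, smul_smul, Finset.insert_comm v u, mul_comm (X v : MvPolynomial V K), ← add_smul]
    have := koszulSign_swap hvu hvA huA
    rw [mul_comm (koszulSign u A), mul_comm (koszulSign v A), this, neg_add_cancel, zero_smul]
  · rintro ⟨u, v⟩ h _ h'
    simp only [Finset.mem_sigma, Finset.mem_sdiff, Finset.mem_insert, not_or] at h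
    exact h.2.2.1 (congrArg Sigma.fst h')
  · rintro ⟨u, v⟩ h
    simp only [Finset.mem_sigma, Finset.mem_sdiff, Finset.mem_insert, not_or] at h ⊢
    tauto
  · rintro ⟨u, v⟩ _
    rfl

theorem compLeft_koszulD (f : N →ₗ[MvPolynomial V K] N') (σ : Finset V) (x : Finset V → N) :
    (f.restrictScalars K).compLeft (Finset V) (koszulD K N σ x) =
      koszulD K N' σ ((f.restrictScalars K).compLeft (Finset V) x) := by
  ext A
  simp [koszulD_apply, LinearMap.compLeft]

theorem koszulChain_map_koszulD {P : Finset V → Submodule K N}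
    (hP : ∀ B v, v ∉ B → ∀ x ∈ P B, (X v : MvPolynomial V K) • x ∈ P (insert v B))
    (σ : Finset V) (j : ℕ) :
    (koszulChain P σ (j + 1)).map (koszulD K N σ) ≤ koszulChain P σ j := by
  rintro _ ⟨x, hx, rfl⟩
  have hx := mem_koszulChain.1 hx
  rw [mem_koszulChain]
  constructor
  · intro A hA hj
    rw [koszulD_apply]
    refine Submodule.sum_mem _ fun v hv => zsmul_mem ?_ _
    rw [Finset.mem_sdiff] at hv
    have h := hP _ v (by simp) _ (hx.1 (insert v A) (Finset.insert_subset hv.1 hA)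
      (by rw [Finset.card_insert_of_notMem hv.2, hj]))
    convert h using 2
    ext u
    by_cases huv : u = v <;> simp [huv, hv]
  · intro A hA
    rw [koszulD_apply]
    refine Finset.sum_eq_zero fun v hv => ?_
    rw [Finset.mem_sdiff] at hv
    rw [hx.2, smul_zero, smul_zero]
    rintro ⟨h₁, h₂⟩
    rw [Finset.card_insert_of_notMem hv.2] at h₂
    exact hA ⟨(Finset.subset_insert _ _).trans h₁, by omega⟩

theorem koszulD_eq_zero_of_mem_koszulChain_zero {P : Finset V → Submodule K N} {σ : Finset V}
    {x : Finset V → N} (hx : x ∈ koszulChain P σ 0) : koszulD K N σ x = 0 := by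
  ext A
  rw [koszulD_apply]
  refine Finset.sum_eq_zero fun v hv => ?_
  rw [(mem_koszulChain.1 hx).2, smul_zero, smul_zero]
  simp

/-- The dimension of the Koszul homology in homological degree `j` and internal degree `σ` of the
module with squarefree pieces `P`. -/
def koszulDim (P : Finset V → Submodule K N) (σ : Finset V) (j : ℕ) : ℕ :=
  quotDim (koszulChain P σ j ⊓ LinearMap.ker (koszulD K N σ))
    ((koszulChain P σ (j + 1)).map (koszulD K N σ))

/-- Dimension shifting in Koszul homology along the exact sequence `0 → ker f → P → f(P) → 0`. -/
theorem koszulDim_map {P : Finset V → Submodule K N}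
    (hP : ∀ B v, v ∉ B → ∀ x ∈ P B, (X v : MvPolynomial V K) • x ∈ P (insert v B))
    (f : N →ₗ[MvPolynomial V K] N') (σ : Finset V) (j : ℕ)
    (hex₁ : koszulChain P σ (j + 1) ⊓ LinearMap.ker (koszulD K N σ) ≤
      (koszulChain P σ (j + 2)).map (koszulD K N σ))
    (hex₀ : koszulChain (fun B => P B ⊓ LinearMap.ker (f.restrictScalars K)) σ j ⊓
      LinearMap.ker (koszulD K N σ) ≤ (koszulChain P σ (j + 1)).map (koszulD K N σ)) :
    koszulDim (fun B => (P B).map (f.restrictScalars K)) σ (j + 1) =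
      koszulDim (fun B => P B ⊓ LinearMap.ker (f.restrictScalars K)) σ j := by
  rw [koszulDim, koszulDim, koszulChain_map, koszulChain_map, koszulChain_inf_ker,
    koszulChain_inf_ker]
  rw [koszulChain_inf_ker] at hex₀
  exact quotDim_connecting _ _ _ (compLeft_koszulD f σ) (koszulD_koszulD σ) _ _ _
    (koszulChain_map_koszulD hP σ (j + 1)) (koszulChain_map_koszulD hP σ j) hex₁ hex₀

/-- In homological degree `0`, a quotient by a kernel that consists of boundaries does not change
the Koszul homology. -/
theorem koszulDim_zero_map {P : Finset V → Submodule K N}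
    (hP : ∀ B v, v ∉ B → ∀ x ∈ P B, (X v : MvPolynomial V K) • x ∈ P (insert v B))
    (f : N →ₗ[MvPolynomial V K] N')
    (σ : Finset V)
    (hker : koszulChain (fun B => P B ⊓ LinearMap.ker (f.restrictScalars K)) σ 0 ≤
      (koszulChain P σ 1).map (koszulD K N σ)) :
    koszulDim (fun B => (P B).map (f.restrictScalars K)) σ 0 = koszulDim P σ 0 := by
  rw [koszulChain_inf_ker] at hker
  rw [koszulDim, koszulDim]
  simp only [koszulChain_map, zero_add]
  have hker0 : ∀ x ∈ koszulChain P σ 0, koszulD K N σ x = 0 := fun x hx =>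
    koszulD_eq_zero_of_mem_koszulChain_zero hx
  refine quotDim_eq_of_maps ((f.restrictScalars K).compLeft (Finset V)) LinearMap.id
    (W := koszulChain P σ 0) ?_ ?_ ?_ ?_ ?_
  · rintro _ ⟨x, hx, rfl⟩
    refine ⟨Submodule.mem_map_of_mem hx, ?_⟩
    change koszulD K N' σ _ = 0
    rw [← compLeft_koszulD, hker0 x hx, map_zero]
  · exact inf_le_left.trans le_sup_left
  · rintro _ ⟨x, hx, rfl⟩
    exact ⟨hx, hker0 x hx⟩
  · rintro x ⟨hx, -⟩
    exact Submodule.mem_sup_left ⟨x, hx, rfl⟩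
  · intro x hx
    constructor
    · rintro ⟨_, ⟨y, hy, rfl⟩, hxy⟩
      rw [← compLeft_koszulD] at hxy
      have hne := koszulChain_map_koszulD hP σ 0
      have h := hker (show x - koszulD K N σ y ∈ _ from
        ⟨sub_mem hx (hne (Submodule.mem_map_of_mem hy)), by simp [hxy]⟩)
      have := add_mem h (Submodule.mem_map_of_mem (f := koszulD K N σ) hy)
      simpa using this
    · rintro ⟨y, hy, hxy⟩
      exact ⟨_, Submodule.mem_map_of_mem hy, by rw [← compLeft_koszulD, hxy]; rfl⟩

end Koszul

/-! ### Homogeneous elements of graded free modules -/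

theorem zeroOneVector_apply {V : Type*} [DecidableEq V] (B : Finset V) (u : V) :
    zeroOneVector B u = if u ∈ B then 1 else 0 := by
  simp [zeroOneVector, Finsupp.finsetSum_apply, Finsupp.single_apply]

theorem zeroOneVector_insert {V : Type*} [DecidableEq V] {B : Finset V} {v : V} (hv : v ∉ B) :
    zeroOneVector (insert v B) = Finsupp.single v 1 + zeroOneVector B := by
  rw [zeroOneVector, Finset.sum_insert hv, zeroOneVector]

section Homogeneous

variable {V K ι κ : Type*} [Field K]

/-- The graded piece of degree `τ` of the free module with basis degrees `deg`. -/
def homPiece (K : Type*) [Field K] (deg : ι → V →₀ ℕ) (τ : V →₀ ℕ) :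
    Submodule K (ι →₀ MvPolynomial V K) where
  carrier := {x | IsHomogeneousElem deg τ x}
  zero_mem' b e he := by simp at he
  add_mem' {x y} hx hy b e he := by
    classical
    rcases Finset.mem_union.1 (MvPolynomial.support_add (by simpa using he)) with h | h
    · exact hx b e h
    · exact hy b e h
  smul_mem' c x hx b e he := hx b e (MvPolynomial.support_smul (a := c) he)

theorem coeff_eq_zero_of_mem_homPiece {deg : ι → V →₀ ℕ} {τ : V →₀ ℕ}
    {x : ι →₀ MvPolynomial V K} (hx : x ∈ homPiece K deg τ) {b : ι} {e : V →₀ ℕ}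
    (h : e + deg b ≠ τ) : coeff e (x b) = 0 := by
  by_contra h'
  exact h (hx b e (MvPolynomial.mem_support_iff.2 h'))

theorem X_smul_mem_homPiece {deg : ι → V →₀ ℕ} {τ : V →₀ ℕ} {x : ι →₀ MvPolynomial V K}
    (hx : x ∈ homPiece K deg τ) (v : V) :
    (X v : MvPolynomial V K) • x ∈ homPiece K deg (Finsupp.single v 1 + τ) := by
  classical
  intro b e he
  rw [Finsupp.smul_apply, smul_eq_mul, mem_support_iff, coeff_X_mul'] at he
  split_ifs at he with h
  · have := hx b _ (mem_support_iff.2 he)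
    rw [← this, ← add_assoc, add_tsub_cancel_of_le]
    rw [Finsupp.single_le_iff]
    exact Nat.one_le_iff_ne_zero.2 (Finsupp.mem_support_iff.1 h)
  · exact absurd rfl he

theorem single_monomial_mem_homPiece (deg : ι → V →₀ ℕ) (b : ι) (e : V →₀ ℕ) (c : K) :
    Finsupp.single b (monomial e c) ∈ homPiece K deg (e + deg b) := by
  classical
  intro b' e' he'
  by_cases h : b = b'
  · subst h
    rw [Finsupp.single_eq_same, mem_support_iff, coeff_monomial] at he'
    split_ifs at he' with h
    · rw [h]
    · exact absurd rfl he'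
  · rw [Finsupp.single_eq_of_ne (Ne.symm h)] at he'
    simp at he'

/-- The projection of a graded free module to its piece of degree `τ`. -/
def homProj (K : Type*) [Field K] (deg : ι → V →₀ ℕ) (τ : V →₀ ℕ) :
    (ι →₀ MvPolynomial V K) →ₗ[K] (ι →₀ MvPolynomial V K) := by
  classical
  exact Finsupp.lsum K fun b => if deg b ≤ τ then
    Finsupp.lsingle b ∘ₗ monomial (τ - deg b) ∘ₗ lcoeff K (τ - deg b) else 0

open Classical in
theorem homProj_single_monomial (deg : ι → V →₀ ℕ) (τ : V →₀ ℕ) (b : ι) (e : V →₀ ℕ) (c : K) :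
    homProj K deg τ (Finsupp.single b (monomial e c)) =
      if e + deg b = τ then Finsupp.single b (monomial e c) else 0 := by
  rw [homProj, Finsupp.lsum_single]
  by_cases h : deg b ≤ τ
  · rw [if_pos h]
    simp only [LinearMap.comp_apply, lcoeff_apply, coeff_monomial, Finsupp.lsingle_apply]
    by_cases h' : e + deg b = τ
    · have : e = τ - deg b := by rw [← h', add_tsub_cancel_right]
      rw [if_pos h', if_pos this, ← this]
    · have : e ≠ τ - deg b := by
        rintro rfl
        exact h' (tsub_add_cancel_of_le h)
      rw [if_neg h', if_neg this, map_zero, Finsupp.single_zero]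
  · rw [if_neg h, if_neg, LinearMap.zero_apply]
    rintro rfl
    exact h le_add_self

theorem freeModule_linearMap_ext {Y : Type*} [AddCommGroup Y] [Module K Y]
    {f g : (ι →₀ MvPolynomial V K) →ₗ[K] Y}
    (h : ∀ b e c, f (Finsupp.single b (monomial e c)) = g (Finsupp.single b (monomial e c))) :
    f = g := by
  refine Finsupp.lhom_ext' fun b => ?_
  refine (basisMonomials V K).ext fun e => ?_
  simpa using h b e 1

theorem homProj_mem (deg : ι → V →₀ ℕ) (τ : V →₀ ℕ) (x : ι →₀ MvPolynomial V K) :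
    homProj K deg τ x ∈ homPiece K deg τ := by
  classical
  have : (homPiece K deg τ).mkQ ∘ₗ homProj K deg τ = 0 := by
    refine freeModule_linearMap_ext fun b e c => ?_
    rw [LinearMap.comp_apply, homProj_single_monomial, Submodule.mkQ_apply, LinearMap.zero_apply,
      Submodule.Quotient.mk_eq_zero]
    split_ifs with h
    · rw [← h]
      exact single_monomial_mem_homPiece deg b e c
    · exact zero_mem _
  simpa using LinearMap.congr_fun this x

open Classical in
theorem coeff_homProj (deg : ι → V →₀ ℕ) (τ : V →₀ ℕ) (x : ι →₀ MvPolynomial V K) (b : ι)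
    (e : V →₀ ℕ) :
    coeff e (homProj K deg τ x b) = if e + deg b = τ then coeff e (x b) else 0 := by
  have : lcoeff K e ∘ₗ Finsupp.lapply b ∘ₗ homProj K deg τ =
      if e + deg b = τ then lcoeff K e ∘ₗ Finsupp.lapply b else 0 := by
    refine freeModule_linearMap_ext fun b' e' c => ?_
    simp only [LinearMap.comp_apply, homProj_single_monomial, Finsupp.lapply_apply]
    by_cases hb : b' = b
    · subst hb
      by_cases he : e' = e
      · subst he
        split_ifs <;> simp
      · split_ifs <;> simp [he]
    · split_ifs <;> simp [hb]
  have := LinearMap.congr_fun this x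
  split_ifs at this ⊢ <;> simpa using this

theorem homProj_of_mem {deg : ι → V →₀ ℕ} {τ : V →₀ ℕ} {x : ι →₀ MvPolynomial V K}
    (hx : x ∈ homPiece K deg τ) : homProj K deg τ x = x := by
  classical
  ext b e
  rw [coeff_homProj]
  split_ifs with h
  · rfl
  · exact (coeff_eq_zero_of_mem_homPiece hx h).symm

theorem homProj_of_mem_of_ne {deg : ι → V →₀ ℕ} {τ τ' : V →₀ ℕ} {x : ι →₀ MvPolynomial V K}
    (hx : x ∈ homPiece K deg τ') (h : τ' ≠ τ) : homProj K deg τ x = 0 := by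
  classical
  ext b e
  rw [coeff_homProj]
  split_ifs with h'
  · rw [coeff_eq_zero_of_mem_homPiece hx]
    · simp
    · exact fun h'' => h (h''.symm.trans h')
  · simp

/-- A homogeneous map commutes with the projections to the graded pieces. The projection `p` of the
target only has to behave as one on the image of `f`. -/
theorem proj_map_eq_map_homProj {Y : Type*} [AddCommGroup Y] [Module K Y]
    {deg : ι → V →₀ ℕ} {τ : V →₀ ℕ} (f : (ι →₀ MvPolynomial V K) →ₗ[K] Y) (p : Y →ₗ[K] Y)
    (h₁ : ∀ x ∈ homPiece K deg τ, p (f x) = f x)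
    (h₂ : ∀ τ' ≠ τ, ∀ x ∈ homPiece K deg τ', p (f x) = 0) (x : ι →₀ MvPolynomial V K) :
    p (f x) = f (homProj K deg τ x) := by
  classical
  have : p ∘ₗ f = f ∘ₗ homProj K deg τ := by
    refine freeModule_linearMap_ext fun b e c => ?_
    rw [LinearMap.comp_apply, LinearMap.comp_apply, homProj_single_monomial]
    have hm := single_monomial_mem_homPiece (K := K) deg b e c
    split_ifs with h
    · exact h₁ _ (h ▸ hm)
    · rw [h₂ _ h _ hm, map_zero]
  exact LinearMap.congr_fun this x

theorem homProj_map {deg : ι → V →₀ ℕ} {deg' : κ → V →₀ ℕ}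
    (f : (ι →₀ MvPolynomial V K) →ₗ[MvPolynomial V K] (κ →₀ MvPolynomial V K))
    (hf : ∀ τ, ∀ x ∈ homPiece K deg τ, f x ∈ homPiece K deg' τ) (τ : V →₀ ℕ)
    (x : ι →₀ MvPolynomial V K) : homProj K deg' τ (f x) = f (homProj K deg τ x) :=
  proj_map_eq_map_homProj (f.restrictScalars K) (homProj K deg' τ)
    (fun x hx => homProj_of_mem (hf τ x hx))
    (fun τ' h x hx => homProj_of_mem_of_ne (hf τ' x hx) h) x

/-- The image of a graded piece under a homogeneous map is the graded piece of the image. -/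
theorem homPiece_map {deg : ι → V →₀ ℕ} {deg' : κ → V →₀ ℕ}
    (f : (ι →₀ MvPolynomial V K) →ₗ[MvPolynomial V K] (κ →₀ MvPolynomial V K))
    (hf : ∀ τ, ∀ x ∈ homPiece K deg τ, f x ∈ homPiece K deg' τ) (τ : V →₀ ℕ) :
    (homPiece K deg τ).map (f.restrictScalars K) =
      homPiece K deg' τ ⊓ (LinearMap.range f).restrictScalars K := by
  ext y
  constructor
  · rintro ⟨x, hx, rfl⟩
    exact ⟨hf τ x hx, x, rfl⟩
  · rintro ⟨hy, x, rfl⟩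
    refine ⟨_, homProj_mem deg τ x, ?_⟩
    exact (homProj_map f hf τ x).symm.trans (homProj_of_mem hy)

end Homogeneous

/-! ### Koszul homology of graded free modules -/

section FreeKoszul

variable {V K ι : Type*} [LinearOrder V] [Field K] [Finite ι]

theorem X_mul_divMonomial_single {p : MvPolynomial V K} {v : V}
    (h : ∀ e ∈ p.support, e v ≠ 0) : X v * p.divMonomial (Finsupp.single v 1) = p := by
  ext e
  rw [coeff_X_mul']
  split_ifs with he
  · rw [coeff_divMonomial, add_tsub_cancel_of_le]
    rw [Finsupp.single_le_iff]
    exact Nat.one_le_iff_ne_zero.2 (Finsupp.mem_support_iff.1 he)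
  · by_contra h'
    exact he (Finsupp.mem_support_iff.2 (h e (mem_support_iff.2 (Ne.symm h'))))

/-- The Koszul complex of a graded free module is exact in positive homological degree, and in
degree `0` up to the constant coefficients at the basis elements of degree `σ`: at a basis element
`b` whose degree misses a vertex `v` of `σ`, wedging with `e_v / X v` is a contracting homotopy. -/
theorem exists_koszulD_eq (deg : ι → V →₀ ℕ) {σ : Finset V} {j : ℕ}
    {x : Finset V → ι →₀ MvPolynomial V K}
    (hx : x ∈ koszulChain (fun B => homPiece K deg (zeroOneVector B)) σ j)
    (hcyc : koszulD K _ σ x = 0)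
    (h₀ : ∀ b, deg b = zeroOneVector σ → x ∅ b = 0) :
    x ∈ (koszulChain (fun B => homPiece K deg (zeroOneVector B)) σ (j + 1)).map
      (koszulD K _ σ) := by
  classical
  obtain ⟨hx₁, hx₂⟩ := mem_koszulChain.1 hx
  -- If the degree of `b` contains all of `σ`, the coordinate at `b` vanishes.
  have hfull : ∀ b, (∀ v ∈ σ, deg b v ≠ 0) → ∀ A, x A b = 0 := by
    intro b hb A
    by_cases hA : A ⊆ σ ∧ A.card = j
    swap
    · rw [hx₂ A hA, Finsupp.zero_apply]
    by_contra hne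
    obtain ⟨e, he⟩ := support_nonempty.2 hne
    have hdeg := hx₁ A hA.1 hA.2 b e he
    have hv : ∀ v, e v + deg b v = if v ∈ σ \ A then 1 else 0 := fun v => by
      rw [← zeroOneVector_apply, ← hdeg, Finsupp.add_apply]
    have hA0 : A = ∅ := by
      by_contra hA'
      obtain ⟨v, hvA⟩ := Finset.nonempty_iff_ne_empty.2 hA'
      have h₁ := hv v
      rw [if_neg (by simp [hvA])] at h₁
      exact hb v (hA.1 hvA) (by omega)
    subst hA0
    refine hne (h₀ b ?_)
    ext v
    have h₁ := hv v
    rw [zeroOneVector_apply]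
    by_cases hvσ : v ∈ σ
    · have := hb v hvσ
      simp only [Finset.sdiff_empty, hvσ, if_true] at h₁ ⊢
      omega
    · simp only [Finset.sdiff_empty, hvσ, if_false] at h₁ ⊢
      omega
  have hex : ∀ b, (∃ v ∈ σ, deg b v = 0) ∨ ∀ A, x A b = 0 := by
    intro b
    by_cases h : ∃ v ∈ σ, deg b v = 0
    · exact Or.inl h
    · push Not at h
      exact Or.inr (hfull b h)
  -- The chain `e_v / X v ∧ x`, coordinate by coordinate, with `v` depending on the basis element.
  let c : ι → Finset V → MvPolynomial V K := fun b A =>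
    if h : ∃ v ∈ σ, deg b v = 0 then
      if h.choose ∈ A then koszulSign h.choose (A.erase h.choose) •
        (x (A.erase h.choose) b).divMonomial (Finsupp.single h.choose 1) else 0
    else 0
  let y : Finset V → ι →₀ MvPolynomial V K := fun A => Finsupp.equivFunOnFinite.symm fun b =>
    c b A
  have hy : ∀ b, (∃ v ∈ σ, deg b v = 0 ∧ ∀ A, y A b = if v ∈ A then
      koszulSign v (A.erase v) • (x (A.erase v) b).divMonomial (Finsupp.single v 1) else 0) ∨
      ((∀ A, y A b = 0) ∧ ∀ A, x A b = 0) := by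
    intro b
    by_cases h : ∃ v ∈ σ, deg b v = 0
    · refine Or.inl ⟨h.choose, h.choose_spec.1, h.choose_spec.2, fun A => ?_⟩
      simp only [y, c, Finsupp.equivFunOnFinite_symm_apply_apply]
      rw [dif_pos h]
    · refine Or.inr ⟨fun A => ?_, (hex b).resolve_left h⟩
      simp only [y, c, Finsupp.equivFunOnFinite_symm_apply_apply]
      rw [dif_neg h]
  refine ⟨y, mem_koszulChain.2 ⟨fun A hA hj b e he => ?_, fun A hA => ?_⟩, ?_⟩
  · rcases hy b with ⟨v, hvσ, hvb, hy⟩ | ⟨hy, -⟩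
    · rw [hy] at he
      split_ifs at he with hvA
      · have he' : e ∈ ((x (A.erase v) b).divMonomial (Finsupp.single v 1)).support := by
          rw [mem_support_iff] at he ⊢
          intro h
          apply he
          rw [← lcoeff_apply (R := K), map_zsmul, lcoeff_apply, h, smul_zero]
        rw [mem_support_iff, coeff_divMonomial, ← mem_support_iff] at he'
        have := hx₁ (A.erase v) ((Finset.erase_subset _ _).trans hA)
          (by rw [Finset.card_erase_of_mem hvA, hj]; rfl) b _ he'
        have hs : σ \ A.erase v = insert v (σ \ A) := by
          ext u
          by_cases huv : u = v <;> simp [huv, hvσ]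
        rw [hs, zeroOneVector_insert (by simp [hvA]), add_assoc] at this
        exact add_left_cancel this
      · simp at he
    · rw [hy] at he
      simp at he
  · ext1 b
    rcases hy b with ⟨v, hvσ, hvb, hy⟩ | ⟨hy, -⟩
    · rw [hy]
      split_ifs with hvA
      · rw [hx₂, Finsupp.zero_apply, zero_divMonomial, smul_zero]
        rintro ⟨h₁, h₂⟩
        refine hA ⟨?_, ?_⟩
        · rw [← Finset.insert_erase hvA]
          exact Finset.insert_subset hvσ h₁
        · rw [← h₂, Finset.card_erase_add_one hvA]
      · rfl
    · exact hy A
  · funext A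
    ext1 b
    have hD : ∀ (z : Finset V → ι →₀ MvPolynomial V K) (A : Finset V), koszulD K _ σ z A b =
        ∑ u ∈ σ \ A, koszulSign u A • (X u * z (insert u A) b) := by
      intro z A
      rw [koszulD_apply, Finsupp.finsetSum_apply]
      rfl
    rw [hD]
    rcases hy b with ⟨v, hvσ, hvb, hy⟩ | ⟨hy, hxb⟩
    swap
    · simp [hy, hxb]
    have hdiv : ∀ A, v ∉ A → X v * (x A b).divMonomial (Finsupp.single v 1) = x A b := by
      intro A hvA
      refine X_mul_divMonomial_single fun e he => ?_
      by_cases hA : A ⊆ σ ∧ A.card = j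
      · have h₁ := DFunLike.congr_fun (hx₁ A hA.1 hA.2 b e he) v
        rw [Finsupp.add_apply, hvb, zeroOneVector_apply, if_pos (by simp [hvσ, hvA])] at h₁
        omega
      · rw [hx₂ A hA] at he
        simp at he
    by_cases hvA : v ∈ A
    -- The cycle condition at `A \ {v}` expresses `X v * x A` by the terms of the differential of
    -- `y` at `A`, multiplied by `X v`.
    · have h₁ : koszulD K _ σ x (A.erase v) b = 0 := by rw [hcyc]; rfl
      have hs : σ \ A.erase v = insert v (σ \ A) := by
        ext u
        by_cases huv : u = v <;> simp [huv, hvσ]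
      rw [hD, hs, Finset.sum_insert (by simp [hvA]), Finset.insert_erase hvA] at h₁
      refine mul_left_cancel₀ (X_ne_zero (R := K) v) ?_
      rw [← one_smul ℤ (X v * x A b), ← koszulSign_mul_self v (A.erase v), mul_smul,
        eq_neg_of_add_eq_zero_left h₁, smul_neg, Finset.mul_sum, Finset.smul_sum,
        ← Finset.sum_neg_distrib]
      refine Finset.sum_congr rfl fun u hu => ?_
      rw [Finset.mem_sdiff] at hu
      have huv : u ≠ v := fun h => hu.2 (h ▸ hvA)
      rw [hy, if_pos (Finset.mem_insert_of_mem hvA), Finset.erase_insert_of_ne huv]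
      have huA : u ∉ A.erase v := fun h => hu.2 (Finset.mem_of_mem_erase h)
      have hvA' : v ∉ insert u (A.erase v) := by simp [huv.symm]
      have hsign := koszulSign_swap huv huA (Finset.notMem_erase v A)
      rw [Finset.insert_erase hvA] at hsign
      have hsign' : koszulSign u A * koszulSign v (insert u (A.erase v)) =
          -(koszulSign v (A.erase v) * koszulSign u (A.erase v)) := by
        have e₁ := koszulSign_mul_self v (A.erase v)
        have e₂ := koszulSign_mul_self v (insert u (A.erase v))
        calc _ = (koszulSign u A * koszulSign v (A.erase v)) * koszulSign v (A.erase v) *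
              koszulSign v (insert u (A.erase v)) := by
                rw [mul_assoc (koszulSign u A), e₁, mul_one]
          _ = _ := by
            rw [hsign]
            linear_combination (-koszulSign u (A.erase v) * koszulSign v (A.erase v)) * e₂
      rw [mul_smul_comm, mul_smul_comm, mul_smul_comm, mul_left_comm, hdiv _ hvA',
        smul_smul, hsign', smul_smul, neg_smul]
    -- Only the summand at `v` of the differential of `y` at `A` is nonzero.
    · rw [Finset.sum_eq_single v]
      · rw [hy, if_pos (Finset.mem_insert_self _ _), Finset.erase_insert hvA, mul_smul_comm,
          smul_smul, koszulSign_mul_self, one_smul, hdiv A hvA]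
      · intro u hu huv
        rw [hy, if_neg (by simp [huv.symm, hvA]), mul_zero, smul_zero]
      · intro h
        simp [hvσ, hvA] at h

end FreeKoszul

/-! ### Betti numbers as dimensions of Koszul homology -/

theorem quotDim_top {K X : Type*} [Field K] [AddCommGroup X] [Module K X] (B : Submodule K X) :
    quotDim ⊤ B = Module.finrank K (X ⧸ B) := by
  refine (Submodule.Quotient.equiv _ _ Submodule.topEquiv ?_).finrank_eq
  ext x
  simp [Submodule.submoduleOf]

section BettiKoszul

variable {V K ι N : Type*} [LinearOrder V] [Field K] [Finite ι]
  [AddCommGroup N] [Module K N] [Module (MvPolynomial V K) N] [IsScalarTower K (MvPolynomial V K) N]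

omit [LinearOrder V] in
theorem coeff_zero_of_mem_span_X {p : MvPolynomial V K}
    (hp : p ∈ Ideal.span (Set.range (X : V → MvPolynomial V K))) : coeff 0 p = 0 := by
  have : Ideal.span (Set.range (X : V → MvPolynomial V K)) ≤ RingHom.ker constantCoeff := by
    rw [Ideal.span_le]
    rintro _ ⟨v, rfl⟩
    simp
  exact this hp

/-- The squarefree pieces of a graded free module. -/
def freePiece (K : Type*) [Field K] (deg : ι → V →₀ ℕ) (B : Finset V) :
    Submodule K (ι →₀ MvPolynomial V K) := homPiece K deg (zeroOneVector B)

omit [Finite ι] in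
theorem X_smul_mem_freePiece (deg : ι → V →₀ ℕ) (B : Finset V) (v : V) (hv : v ∉ B)
    (x : ι →₀ MvPolynomial V K) (hx : x ∈ freePiece K deg B) :
    (X v : MvPolynomial V K) • x ∈ freePiece K deg (insert v B) := by
  rw [freePiece, zeroOneVector_insert hv]
  exact X_smul_mem_homPiece hx v

theorem mem_koszulD_map_of_coeff_zero (deg : ι → V →₀ ℕ) {σ : Finset V} {j : ℕ}
    {x : Finset V → ι →₀ MvPolynomial V K} (hx : x ∈ koszulChain (freePiece K deg) σ j)
    (hcyc : koszulD K _ σ x = 0) (h₀ : ∀ b, deg b = zeroOneVector σ → coeff 0 (x ∅ b) = 0) :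
    x ∈ (koszulChain (freePiece K deg) σ (j + 1)).map (koszulD K _ σ) := by
  refine exists_koszulD_eq deg hx hcyc fun b hb => ?_
  by_cases hj : j = 0
  · have h := (mem_koszulChain.1 hx).1 ∅ (Finset.empty_subset σ) (by simp [hj])
    rw [Finset.sdiff_empty] at h
    ext e
    by_cases he : e = 0
    · rw [he, h₀ b hb, coeff_zero]
    · rw [coeff_zero]
      refine coeff_eq_zero_of_mem_homPiece h fun h' => he ?_
      rw [hb] at h'
      exact add_eq_right.1 h'
  · rw [(mem_koszulChain.1 hx).2, Finsupp.zero_apply]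
    simp [Ne.symm hj]

theorem koszulDim_freePiece_zero (deg : ι → V →₀ ℕ) (σ : Finset V) :
    koszulDim (freePiece K deg) σ 0 = Nat.card {b // deg b = zeroOneVector σ} := by
  classical
  have := Fintype.ofFinite {b // deg b = zeroOneVector σ}
  let q : (Finset V → ι →₀ MvPolynomial V K) →ₗ[K] ({b // deg b = zeroOneVector σ} → K) :=
    LinearMap.pi fun b => lcoeff K 0 ∘ₗ Finsupp.lapply b.1 ∘ₗ LinearMap.proj ∅
  have hq : ∀ x b, q x b = coeff 0 (x ∅ b.1) := fun _ _ => rfl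
  have hle : koszulChain (freePiece K deg) σ 0 ≤ LinearMap.ker (koszulD K _ σ) := fun x hx =>
    koszulD_eq_zero_of_mem_koszulChain_zero hx
  rw [koszulDim, inf_eq_left.2 hle]
  have h₁ : quotDim (koszulChain (freePiece K deg) σ 0)
      ((koszulChain (freePiece K deg) σ (0 + 1)).map (koszulD K _ σ)) =
      quotDim (koszulChain (freePiece K deg) σ 0) ((⊥ : Submodule K _).comap q) := by
    refine quotDim_congr fun x hx => ?_
    rw [Submodule.mem_comap, Submodule.mem_bot]
    constructor
    · rintro ⟨y, -, rfl⟩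
      ext b
      rw [hq, koszulD_apply, Finsupp.finsetSum_apply, ← lcoeff_apply (R := K), map_sum]
      refine Finset.sum_eq_zero fun v _ => ?_
      rw [Finsupp.smul_apply, map_zsmul, Finsupp.smul_apply, smul_eq_mul, lcoeff_apply,
        coeff_X_mul', if_neg (by simp), smul_zero]
    · intro h
      exact mem_koszulD_map_of_coeff_zero deg hx (hle hx) fun b hb => congrFun h ⟨b, hb⟩
  rw [h₁, quotDim_comap q (Z := ⊤) le_top, quotDim_top,
    (Submodule.quotEquivOfEqBot _ rfl).finrank_eq, Module.finrank_fintype_fun_eq_card,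
    Nat.card_eq_fintype_card]
  rintro g -
  refine Submodule.mem_sup_left ⟨fun A => if A = ∅ then Finsupp.equivFunOnFinite.symm fun b =>
    if h : deg b = zeroOneVector σ then C (g ⟨b, h⟩) else 0 else 0, ?_, ?_⟩
  · refine mem_koszulChain.2 ⟨fun A _ hA => ?_, fun A hA => if_neg ?_⟩
    · rw [Finset.card_eq_zero] at hA
      subst hA
      rw [if_pos rfl, Finset.sdiff_empty]
      intro b e he
      rw [Finsupp.equivFunOnFinite_symm_apply_apply] at he
      split_ifs at he with h
      · rw [mem_support_iff, coeff_C] at he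
        split_ifs at he with h'
        · rw [← h', zero_add, h]
        · exact absurd rfl he
      · simp at he
    · rintro rfl
      exact hA ⟨Finset.empty_subset _, rfl⟩
  · ext b
    rw [hq, if_pos rfl, Finsupp.equivFunOnFinite_symm_apply_apply, dif_pos b.2, coeff_C, if_pos rfl]

omit [LinearOrder V] [Finite ι] in
theorem mem_koszulChain_inf_ker [DecidableEq V] {deg : ι → V →₀ ℕ}
    {f : (ι →₀ MvPolynomial V K) →ₗ[MvPolynomial V K] N} {σ : Finset V} {j : ℕ}
    {x : Finset V → ι →₀ MvPolynomial V K} :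
    x ∈ koszulChain (fun B => freePiece K deg B ⊓ LinearMap.ker (f.restrictScalars K)) σ j ↔
      x ∈ koszulChain (freePiece K deg) σ j ∧ ∀ A, f (x A) = 0 := by
  rw [koszulChain_inf_ker, Submodule.mem_inf, LinearMap.mem_ker, funext_iff]
  rfl

/-- Dimension shifting along a minimal presentation. -/
theorem koszulDim_map_freePiece_succ (deg : ι → V →₀ ℕ)
    (f : (ι →₀ MvPolynomial V K) →ₗ[MvPolynomial V K] N)
    (hmin : ∀ x, f x = 0 → ∀ b, coeff 0 (x b) = 0) (σ : Finset V) (j : ℕ) :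
    koszulDim (fun B => (freePiece K deg B).map (f.restrictScalars K)) σ (j + 1) =
      koszulDim (fun B => freePiece K deg B ⊓ LinearMap.ker (f.restrictScalars K)) σ j := by
  refine koszulDim_map (P := freePiece K deg) (X_smul_mem_freePiece deg) f σ j ?_ ?_
  · rintro x ⟨hx, hx'⟩
    refine mem_koszulD_map_of_coeff_zero deg hx hx' fun b _ => ?_
    rw [(mem_koszulChain.1 hx).2 ∅ (by simp)]
    simp
  · rintro x ⟨hx, hx'⟩
    have hx := mem_koszulChain_inf_ker.1 hx
    exact mem_koszulD_map_of_coeff_zero deg hx.1 hx' fun b _ => hmin _ (hx.2 ∅) b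

theorem koszulDim_map_freePiece_zero (deg : ι → V →₀ ℕ)
    (f : (ι →₀ MvPolynomial V K) →ₗ[MvPolynomial V K] N)
    (hmin : ∀ x, f x = 0 → ∀ b, coeff 0 (x b) = 0) (σ : Finset V) :
    koszulDim (fun B => (freePiece K deg B).map (f.restrictScalars K)) σ 0 =
      Nat.card {b // deg b = zeroOneVector σ} := by
  rw [koszulDim_zero_map (P := freePiece K deg) (X_smul_mem_freePiece deg),
    koszulDim_freePiece_zero]
  intro x hx
  rw [mem_koszulChain_inf_ker] at hx
  exact mem_koszulD_map_of_coeff_zero deg hx.1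
    (koszulD_eq_zero_of_mem_koszulChain_zero hx.1) fun b _ => hmin _ (hx.2 ∅) b

end BettiKoszul

section Resolution

variable {V K M : Type*} [LinearOrder V] [Field K] [AddCommGroup M] [Module K M]
  [Module (MvPolynomial V K) M] {piece : (V →₀ ℕ) → Submodule K M}

omit [LinearOrder V] in
theorem MinimalFreeResolution.coeff_zero_of_d_eq_zero (F : MinimalFreeResolution piece) (k : ℕ)
    (x) (hx : F.d k x = 0) (b) : coeff 0 (x b) = 0 := by
  obtain ⟨y, rfl⟩ := (F.exact_d k x).1 hx
  exact coeff_zero_of_mem_span_X (F.minimal _ _ _)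

omit [LinearOrder V] in
theorem MinimalFreeResolution.coeff_zero_of_ε_eq_zero (F : MinimalFreeResolution piece)
    (x) (hx : F.ε x = 0) (b) : coeff 0 (x b) = 0 := by
  obtain ⟨y, rfl⟩ := (F.exact_ε x).1 hx
  exact coeff_zero_of_mem_span_X (F.minimal _ _ _)

/-- The Koszul homology of the syzygy modules of a minimal resolution. -/
theorem MinimalFreeResolution.koszulDim_syzygy (F : MinimalFreeResolution piece) (σ : Finset V)
    (j k : ℕ) :
    koszulDim (fun B => (freePiece K (F.deg (k + 1)) B).map ((F.d k).restrictScalars K)) σ j =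
      F.betti (k + 1 + j) (zeroOneVector σ) := by
  induction j generalizing k with
  | zero =>
    have := F.finite_ι (k + 1)
    exact koszulDim_map_freePiece_zero _ _ (F.coeff_zero_of_d_eq_zero k) σ
  | succ j ih =>
    have := F.finite_ι (k + 1)
    rw [koszulDim_map_freePiece_succ _ _ (F.coeff_zero_of_d_eq_zero k), add_comm j, ← add_assoc,
      ← ih]
    congr 1
    funext B
    rw [freePiece, freePiece, homPiece_map _ (F.d_homogeneous (k + 1)),
      ← (F.exact_d k).linearMap_ker_eq]
    rfl

/-- The Betti number `β_{j+1,σ}` is the dimension of the Koszul homology of the resolved module. -/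
theorem MinimalFreeResolution.koszulDim_eq_betti [IsScalarTower K (MvPolynomial V K) M]
    (F : MinimalFreeResolution piece)
    (hpiece : ∀ τ, (homPiece K (F.deg 0) τ).map (F.ε.restrictScalars K) = piece τ)
    (σ : Finset V) (j : ℕ) :
    koszulDim (fun B => piece (zeroOneVector B)) σ (j + 1) =
      F.betti (j + 1) (zeroOneVector σ) := by
  have := F.finite_ι 0
  simp only [← hpiece]
  have h := koszulDim_map_freePiece_succ (F.deg 0) F.ε F.coeff_zero_of_ε_eq_zero σ j
  simp only [freePiece] at h
  rw [h, add_comm j, ← zero_add 1, ← F.koszulDim_syzygy σ j 0]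
  congr 1
  funext B
  rw [freePiece, homPiece_map _ (F.d_homogeneous 0), ← F.exact_ε.linearMap_ker_eq]
  rfl

end Resolution

/-! ### The graded pieces of the quotient by the edge ideal -/

section EdgeIdeal

variable {V K : Type*} [Field K]

/-- `I` is a monomial ideal: with a polynomial it contains all terms of that polynomial. -/
def IsMonomialIdeal (I : Ideal (MvPolynomial V K)) : Prop :=
  ∀ p ∈ I, ∀ τ, monomial τ (coeff τ p) ∈ I

theorem edgeIdeal_eq_span_monomial (G : SimpleGraph V) : edgeIdeal K G =
    Ideal.span ((fun s => monomial s (1 : K)) ''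
      {s | ∃ u v, G.Adj u v ∧ s = Finsupp.single u 1 + Finsupp.single v 1}) := by
  rw [edgeIdeal]
  congr 1
  ext p
  constructor
  · rintro ⟨u, v, h, rfl⟩
    exact ⟨_, ⟨u, v, h, rfl⟩, by simp [X, monomial_mul]⟩
  · rintro ⟨_, ⟨u, v, h, rfl⟩, rfl⟩
    exact ⟨u, v, h, by simp [X, monomial_mul]⟩

theorem mem_edgeIdeal_iff {G : SimpleGraph V} {p : MvPolynomial V K} : p ∈ edgeIdeal K G ↔
    ∀ e ∈ p.support, ∃ u v, G.Adj u v ∧ Finsupp.single u 1 + Finsupp.single v 1 ≤ e := by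
  rw [edgeIdeal_eq_span_monomial, mem_ideal_span_monomial_image]
  refine forall₂_congr fun e _ => ⟨?_, ?_⟩
  · rintro ⟨_, ⟨u, v, h, rfl⟩, h'⟩
    exact ⟨u, v, h, h'⟩
  · rintro ⟨u, v, h, h'⟩
    exact ⟨_, ⟨u, v, h, rfl⟩, h'⟩

theorem isMonomialIdeal_edgeIdeal (G : SimpleGraph V) : IsMonomialIdeal (edgeIdeal K G) := by
  classical
  intro p hp τ
  rw [mem_edgeIdeal_iff] at hp ⊢
  intro e he
  rw [mem_support_iff, coeff_monomial] at he
  split_ifs at he with h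
  · subst h
    exact hp _ (mem_support_iff.2 he)
  · exact absurd rfl he

theorem mem_quotientPiece {I : Ideal (MvPolynomial V K)} {τ : V →₀ ℕ} {x : MvPolynomial V K ⧸ I} :
    x ∈ quotientPiece I τ ↔ ∃ c : K, x = c • Ideal.Quotient.mk I (monomial τ 1) := by
  rw [quotientPiece, Submodule.map_span, Set.image_singleton, Submodule.mem_span_singleton]
  exact exists_congr fun c => eq_comm

/-- The projection of the quotient by a monomial ideal to its piece of degree `τ`. -/
def quotientProj {I : Ideal (MvPolynomial V K)} (hI : IsMonomialIdeal I) (τ : V →₀ ℕ) :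
    (MvPolynomial V K ⧸ I) →ₗ[K] (MvPolynomial V K ⧸ I) :=
  (I.restrictScalars K).mapQ (I.restrictScalars K) (monomial τ ∘ₗ lcoeff K τ)
    fun p hp => hI p hp τ

theorem quotientProj_mk {I : Ideal (MvPolynomial V K)} (hI : IsMonomialIdeal I) (τ : V →₀ ℕ)
    (p : MvPolynomial V K) : quotientProj hI τ (Ideal.Quotient.mk I p) =
      Ideal.Quotient.mk I (monomial τ (coeff τ p)) := rfl

/-- The augmentation maps each graded piece of `F₀` onto the corresponding piece of the quotient. -/
theorem map_ε_homPiece {I : Ideal (MvPolynomial V K)} (hI : IsMonomialIdeal I)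
    (F : MinimalFreeResolution (quotientPiece I)) (τ : V →₀ ℕ) :
    (homPiece K (F.deg 0) τ).map (F.ε.restrictScalars K) = quotientPiece I τ := by
  classical
  have hproj : ∀ τ', ∀ y ∈ quotientPiece I τ', quotientProj hI τ y = if τ' = τ then y else 0 := by
    intro τ' y hy
    obtain ⟨c, rfl⟩ := mem_quotientPiece.1 hy
    rw [map_smul, quotientProj_mk, coeff_monomial]
    split_ifs with h
    · rw [h]
    · simp
  refine le_antisymm ?_ fun y hy => ?_
  · rintro _ ⟨x, hx, rfl⟩
    exact F.ε_homogeneous τ x hx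
  · obtain ⟨x, rfl⟩ := F.surjective_ε y
    refine ⟨_, homProj_mem (F.deg 0) τ x, ?_⟩
    have h := proj_map_eq_map_homProj (deg := F.deg 0) (τ := τ) (F.ε.restrictScalars K)
      (quotientProj hI τ)
      (fun x hx => (hproj τ _ (F.ε_homogeneous τ x hx)).trans (if_pos rfl))
      (fun τ' h x hx => (hproj τ' _ (F.ε_homogeneous τ' x hx)).trans (if_neg h)) x
    rw [← h]
    exact (hproj τ _ hy).trans (if_pos rfl)

theorem smul_mk_monomial_eq_zero [DecidableEq V] {G : SimpleGraph V} {B : Finset V} {c : K} :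
    c • Ideal.Quotient.mk (edgeIdeal K G) (monomial (zeroOneVector B) 1) = 0 ↔
      c = 0 ∨ ∃ u ∈ B, ∃ v ∈ B, G.Adj u v := by
  classical
  have h₁ : c • Ideal.Quotient.mk (edgeIdeal K G) (monomial (zeroOneVector B) 1) =
      Ideal.Quotient.mk (edgeIdeal K G) (monomial (zeroOneVector B) c) := by
    rw [← Ideal.Quotient.mkₐ_eq_mk K, ← map_smul, smul_monomial, smul_eq_mul, mul_one]
  rw [h₁, Ideal.Quotient.eq_zero_iff_mem, mem_edgeIdeal_iff]
  by_cases hc : c = 0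
  · simp [hc]
  rw [support_monomial, if_neg hc]
  simp only [hc, Finset.mem_singleton, forall_eq, false_or]
  constructor
  · rintro ⟨u, v, h, hle⟩
    have hu := hle u
    have hv := hle v
    rw [zeroOneVector_apply] at hu hv
    refine ⟨u, ?_, v, ?_, h⟩
    · by_contra hn
      simp [hn] at hu
    · by_contra hn
      simp [hn] at hv
  · rintro ⟨u, hu, v, hv, h⟩
    refine ⟨u, v, h, fun w => ?_⟩
    rw [zeroOneVector_apply, Finsupp.add_apply, Finsupp.single_apply, Finsupp.single_apply]
    have := h.ne
    by_cases h₁ : u = w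
    · subst h₁
      simp [hu, this.symm]
    · by_cases h₂ : v = w
      · subst h₂
        simp [hv, this]
      · simp [h₁, h₂]

end EdgeIdeal

/-! ### The linear strand of the Koszul homology of the edge ring -/

section LinearStrand

variable {V K : Type*} [LinearOrder V] [Field K]

theorem exists_eq_erase {σ A : Finset V} {i : ℕ} (hσ : σ.card = i + 1) (hA : A ⊆ σ)
    (hi : A.card = i) : ∃ v ∈ σ, A = σ.erase v := by
  have h : (σ \ A).card = 1 := by
    rw [Finset.card_sdiff_of_subset hA]
    omega
  obtain ⟨v, hv⟩ := Finset.card_eq_one.1 h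
  have hv' : v ∈ σ \ A := by simp [hv]
  rw [Finset.mem_sdiff] at hv'
  refine ⟨v, hv'.1, Finset.eq_of_subset_of_card_le (fun u hu => ?_) ?_⟩
  · exact Finset.mem_erase.2 ⟨fun h => hv'.2 (h ▸ hu), hA hu⟩
  · rw [Finset.card_erase_of_mem hv'.1]
    omega

theorem sdiff_erase_self {σ : Finset V} {v : V} (hv : v ∈ σ) : σ \ σ.erase v = {v} := by
  ext u
  by_cases h : u = v <;> simp [h, hv]

/-- The image of the squarefree monomial of a set of vertices in the edge ring. -/
def mkMonomial (K : Type*) [Field K] (G : SimpleGraph V) (B : Finset V) :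
    MvPolynomial V K ⧸ edgeIdeal K G :=
  Ideal.Quotient.mk _ (monomial (zeroOneVector B) 1)

theorem X_smul_mkMonomial (G : SimpleGraph V) {B : Finset V} {v : V} (hv : v ∉ B) :
    (X v : MvPolynomial V K) • mkMonomial K G B = mkMonomial K G (insert v B) := by
  rw [mkMonomial, mkMonomial, ← Ideal.Quotient.mk_eq_mk, ← Submodule.Quotient.mk_smul,
    zeroOneVector_insert hv, smul_eq_mul, X, monomial_mul, one_mul]
  rfl

/-- The squarefree pieces of the edge ring. -/
def edgePiece (K : Type*) [Field K] (G : SimpleGraph V) (B : Finset V) :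
    Submodule K (MvPolynomial V K ⧸ edgeIdeal K G) :=
  quotientPiece (edgeIdeal K G) (zeroOneVector B)

omit [LinearOrder V] in
theorem mem_edgePiece {G : SimpleGraph V} {B : Finset V} {x : MvPolynomial V K ⧸ edgeIdeal K G} :
    x ∈ edgePiece K G B ↔ ∃ c : K, x = c • mkMonomial K G B := mem_quotientPiece

theorem X_smul_mem_edgePiece (G : SimpleGraph V) (B : Finset V) (v : V) (hv : v ∉ B)
    (x : MvPolynomial V K ⧸ edgeIdeal K G) (hx : x ∈ edgePiece K G B) :
    (X v : MvPolynomial V K) • x ∈ edgePiece K G (insert v B) := by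
  obtain ⟨c, rfl⟩ := mem_edgePiece.1 hx
  exact mem_edgePiece.2 ⟨c, by rw [smul_comm, X_smul_mkMonomial G hv]⟩

/-- The Koszul chain `∑ v, ± g v * X v ⊗ e_{σ \ {v}}` given by a function `g` on the vertices. -/
def strandChain (K : Type*) [Field K] (G : SimpleGraph V) (σ : Finset V) :
    (V → K) →ₗ[K] (Finset V → MvPolynomial V K ⧸ edgeIdeal K G) :=
  LinearMap.pi fun A => ∑ v ∈ σ, if A = σ.erase v then
    koszulSign v A • (LinearMap.proj v : (V → K) →ₗ[K] K).smulRight (mkMonomial K G {v}) else 0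

theorem strandChain_erase (G : SimpleGraph V) {σ : Finset V} (g : V → K) {v : V} (hv : v ∈ σ) :
    strandChain K G σ g (σ.erase v) =
      koszulSign v (σ.erase v) • g v • mkMonomial K G {v} := by
  simp only [strandChain, LinearMap.pi_apply, LinearMap.sum_apply]
  rw [Finset.sum_eq_single v]
  · rw [if_pos rfl]
    rfl
  · intro u hu huv
    rw [if_neg, LinearMap.zero_apply]
    intro h
    have : u ∈ σ.erase v := Finset.mem_erase.2 ⟨huv, hu⟩
    rw [h] at this
    simp at this
  · exact fun h => absurd hv h

theorem strandChain_eq_zero (G : SimpleGraph V) {σ A : Finset V} (g : V → K)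
    (hA : ∀ v ∈ σ, A ≠ σ.erase v) : strandChain K G σ g A = 0 := by
  simp only [strandChain, LinearMap.pi_apply, LinearMap.sum_apply]
  refine Finset.sum_eq_zero fun v hv => ?_
  rw [if_neg (hA v hv), LinearMap.zero_apply]

theorem strandChain_mem (G : SimpleGraph V) {σ : Finset V} {i : ℕ} (hσ : σ.card = i + 1)
    (g : V → K) : strandChain K G σ g ∈ koszulChain (edgePiece K G) σ i := by
  refine mem_koszulChain.2 ⟨fun A hA hi => ?_, fun A hA => strandChain_eq_zero G g ?_⟩
  · obtain ⟨v, hv, rfl⟩ := exists_eq_erase hσ hA hi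
    rw [strandChain_erase G g hv, sdiff_erase_self hv]
    exact zsmul_mem (mem_edgePiece.2 ⟨_, rfl⟩) _
  · rintro v hv rfl
    exact hA ⟨Finset.erase_subset _ _, by rw [Finset.card_erase_of_mem hv, hσ]; rfl⟩

theorem koszulChain_ext {G : SimpleGraph V} {σ : Finset V} {i : ℕ} (hσ : σ.card = i + 1)
    {x y : Finset V → MvPolynomial V K ⧸ edgeIdeal K G}
    (hx : x ∈ koszulChain (edgePiece K G) σ i) (hy : y ∈ koszulChain (edgePiece K G) σ i)
    (h : ∀ v ∈ σ, x (σ.erase v) = y (σ.erase v)) : x = y := by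
  funext A
  by_cases hA : A ⊆ σ ∧ A.card = i
  · obtain ⟨v, hv, rfl⟩ := exists_eq_erase hσ hA.1 hA.2
    exact h v hv
  · rw [(mem_koszulChain.1 hx).2 A hA, (mem_koszulChain.1 hy).2 A hA]

theorem exists_eq_strandChain {G : SimpleGraph V} {σ : Finset V} {i : ℕ} (hσ : σ.card = i + 1)
    {x : Finset V → MvPolynomial V K ⧸ edgeIdeal K G}
    (hx : x ∈ koszulChain (edgePiece K G) σ i) : ∃ g : V → K, x = strandChain K G σ g := by
  have : ∀ v, ∃ c : K, v ∈ σ → x (σ.erase v) = c • mkMonomial K G {v} := by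
    intro v
    by_cases hv : v ∈ σ
    · have h := (mem_koszulChain.1 hx).1 (σ.erase v) (Finset.erase_subset _ _)
        (by rw [Finset.card_erase_of_mem hv, hσ]; rfl)
      rw [sdiff_erase_self hv] at h
      obtain ⟨c, hc⟩ := mem_edgePiece.1 h
      exact ⟨c, fun _ => hc⟩
    · exact ⟨0, fun h => absurd h hv⟩
  choose c hc using this
  refine ⟨fun v => koszulSign v (σ.erase v) • c v,
    koszulChain_ext hσ hx (strandChain_mem G hσ _) ?_⟩
  intro v hv
  rw [strandChain_erase G _ hv, hc v hv, smul_assoc, smul_smul, koszulSign_mul_self, one_smul]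

theorem strandChain_injective (G : SimpleGraph V) {σ : Finset V} {g g' : V → K}
    (h : strandChain K G σ g = strandChain K G σ g') : ∀ v ∈ σ, g v = g' v := by
  intro v hv
  have h₁ : strandChain K G σ (g - g') (σ.erase v) = 0 := by
    rw [map_sub, h, sub_self]
    rfl
  rw [strandChain_erase G _ hv] at h₁
  have h₂ := congrArg (koszulSign v (σ.erase v) • ·) h₁
  simp only [smul_zero, smul_smul, koszulSign_mul_self, one_smul] at h₂
  rcases smul_mk_monomial_eq_zero.1 h₂ with h₃ | ⟨a, ha, b, hb, hab⟩
  · exact sub_eq_zero.1 h₃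
  · rw [Finset.mem_singleton] at ha hb
    exact absurd (ha.trans hb.symm) hab.ne

/-- The differential compares the values of `g` at the two vertices missing from `A`. -/
theorem koszulD_strandChain (G : SimpleGraph V) {σ : Finset V} (g : V → K) {A : Finset V} {u w : V}
    (huw : u ≠ w) (hA : A ⊆ σ) (h : σ \ A = {u, w}) :
    koszulD K _ σ (strandChain K G σ g) A =
      (koszulSign u A * koszulSign w (insert u A)) • (g w - g u) • mkMonomial K G {u, w} := by
  have hu : u ∈ σ ∧ u ∉ A := by rw [← Finset.mem_sdiff, h]; simp
  have hw : w ∈ σ ∧ w ∉ A := by rw [← Finset.mem_sdiff, h]; simp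
  have hA' : ∀ a, a ∈ A ↔ a ∈ σ ∧ a ≠ u ∧ a ≠ w := by
    intro a
    have h₁ : a ∈ σ \ A ↔ a = u ∨ a = w := by rw [h]; simp
    rw [Finset.mem_sdiff] at h₁
    constructor
    · exact fun ha => ⟨hA ha, fun h => hu.2 (h ▸ ha), fun h => hw.2 (h ▸ ha)⟩
    · rintro ⟨h₂, h₃, h₄⟩
      by_contra hn
      exact (h₁.1 ⟨h₂, hn⟩).elim h₃ h₄
  have e₁ : insert u A = σ.erase w := by
    ext a
    by_cases hau : a = u
    · simp [hau, huw, hu]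
    · simp [hau, hA', and_comm]
  have e₂ : insert w A = σ.erase u := by
    ext a
    by_cases hau : a = w
    · simp [hau, huw.symm, hw]
    · simp [hau, hA', and_comm]
  rw [koszulD_apply, h, Finset.sum_pair huw, e₁, e₂, strandChain_erase G g hw.1,
    strandChain_erase G g hu.1, ← e₁, ← e₂,
    smul_comm (X u : MvPolynomial V K), smul_comm (X u : MvPolynomial V K),
    smul_comm (X w : MvPolynomial V K), smul_comm (X w : MvPolynomial V K),
    X_smul_mkMonomial G (by simpa using huw), X_smul_mkMonomial G (by simpa using huw.symm),
    smul_smul, smul_smul, Finset.pair_comm w u]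
  have hsign : koszulSign w A * koszulSign u (insert w A) =
      -(koszulSign u A * koszulSign w (insert u A)) := by
    linear_combination koszulSign_swap huw hu.2 hw.2
  rw [hsign, sub_smul, smul_sub, neg_smul, sub_eq_add_neg]

theorem koszulD_strandChain_eq_zero_iff (G : SimpleGraph V) {σ : Finset V} {j : ℕ}
    (hσ : σ.card = j + 2) (g : V → K) : koszulD K _ σ (strandChain K G σ g) = 0 ↔
      ∀ u ∈ σ, ∀ w ∈ σ, ¬G.Adj u w → g u = g w := by
  constructor
  · intro h u hu w hw hadj
    by_cases huw : u = w
    · rw [huw]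
    have hs : σ \ (σ \ {u, w}) = {u, w} := by
      exact Finset.sdiff_sdiff_eq_self (by simp [Finset.insert_subset_iff, hu, hw])
    have h₁ := koszulD_strandChain G g huw Finset.sdiff_subset hs
    rw [h, Pi.zero_apply] at h₁
    have h₂ := congrArg (koszulSign u (σ \ {u, w}) • ·) h₁
    simp only [smul_zero, smul_smul, ← mul_assoc, koszulSign_mul_self, one_mul] at h₂
    have h₃ := congrArg (koszulSign w (insert u (σ \ {u, w})) • ·) h₂
    simp only [smul_zero, smul_smul, koszulSign_mul_self, one_smul] at h₃
    rcases smul_mk_monomial_eq_zero.1 h₃.symm with h₄ | ⟨a, ha, b, hb, hab⟩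
    · exact (sub_eq_zero.1 h₄).symm
    · simp only [Finset.mem_insert, Finset.mem_singleton] at ha hb
      rcases ha with rfl | rfl <;> rcases hb with rfl | rfl
      · exact absurd hab (G.irrefl)
      · exact absurd hab hadj
      · exact absurd hab.symm hadj
      · exact absurd hab (G.irrefl)
  · intro h
    have hmem := koszulChain_map_koszulD (X_smul_mem_edgePiece G) σ j
      (Submodule.mem_map_of_mem (strandChain_mem G (i := j + 1) hσ g))
    funext A
    by_cases hA : A ⊆ σ ∧ A.card = j
    · have hc : (σ \ A).card = 2 := by
        rw [Finset.card_sdiff_of_subset hA.1]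
        omega
      obtain ⟨u, w, huw, hs⟩ := Finset.card_eq_two.1 hc
      have hu : u ∈ σ := (Finset.mem_sdiff.1 (by rw [hs]; simp : u ∈ σ \ A)).1
      have hw : w ∈ σ := (Finset.mem_sdiff.1 (by rw [hs]; simp : w ∈ σ \ A)).1
      rw [koszulD_strandChain G g huw hA.1 hs]
      have : (g w - g u) • mkMonomial K G {u, w} = 0 := by
        refine smul_mk_monomial_eq_zero.2 ?_
        by_cases hadj : G.Adj u w
        · exact Or.inr ⟨u, by simp, w, by simp, hadj⟩
        · exact Or.inl (sub_eq_zero.2 (h u hu w hw hadj).symm)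
      rw [this, smul_zero, Pi.zero_apply]
    · exact (mem_koszulChain.1 hmem).2 A hA

/-- The boundaries in the linear strand are given by the constant functions. -/
theorem strandChain_mem_boundaries_iff (G : SimpleGraph V) {σ : Finset V} {i : ℕ}
    (hσ : σ.card = i + 1) (g : V → K) :
    strandChain K G σ g ∈ (koszulChain (edgePiece K G) σ (i + 1)).map (koszulD K _ σ) ↔
      ∃ c : K, ∀ v ∈ σ, g v = c := by
  have key : ∀ y ∈ koszulChain (edgePiece K G) σ (i + 1), ∀ c : K, y σ = c • mkMonomial K G ∅ →
      koszulD K _ σ y = strandChain K G σ fun _ => c := by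
    intro y hy c hc
    refine koszulChain_ext hσ (koszulChain_map_koszulD (X_smul_mem_edgePiece G) σ i
      (Submodule.mem_map_of_mem hy)) (strandChain_mem G hσ _) fun v hv => ?_
    rw [strandChain_erase G _ hv, koszulD_apply, sdiff_erase_self hv, Finset.sum_singleton,
      Finset.insert_erase hv, hc, smul_comm (X v : MvPolynomial V K),
      X_smul_mkMonomial G (by simp)]
    rfl
  constructor
  · rintro ⟨y, hy, h⟩
    have h₁ := (mem_koszulChain.1 hy).1 σ subset_rfl hσ
    rw [Finset.sdiff_self] at h₁
    obtain ⟨c, hc⟩ := mem_edgePiece.1 h₁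
    rw [key y hy c hc] at h
    exact ⟨c, fun v hv => (strandChain_injective G h v hv).symm⟩
  · rintro ⟨c, hc⟩
    have hy : (Pi.single σ (c • mkMonomial K G ∅) : Finset V → MvPolynomial V K ⧸ edgeIdeal K G) ∈
        koszulChain (edgePiece K G) σ (i + 1) := by
      refine mem_koszulChain.2 ⟨fun A hA hi => ?_, fun A hA => ?_⟩
      · have : A = σ := Finset.eq_of_subset_of_card_le hA (by omega)
        rw [this, Pi.single_eq_same, Finset.sdiff_self]
        exact mem_edgePiece.2 ⟨c, rfl⟩
      · rw [Pi.single_eq_of_ne]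
        rintro rfl
        exact hA ⟨subset_rfl, hσ⟩
    refine ⟨_, hy, ?_⟩
    rw [key _ hy c (Pi.single_eq_same _ _)]
    refine koszulChain_ext hσ (strandChain_mem G hσ _) (strandChain_mem G hσ _) fun v hv => ?_
    rw [strandChain_erase G _ hv, strandChain_erase G _ hv, hc v hv]

/-- The linear strand of the Koszul homology of the edge ring is the reduced zeroth cohomology of
the complement of the induced subgraph: functions on its components modulo constants. -/
theorem koszulDim_edgePiece (G : SimpleGraph V) {σ : Finset V} {j : ℕ} (hσ : σ.card = j + 2) :
    koszulDim (edgePiece K G) σ (j + 1) + 1 =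
      Nat.card (G.induce (σ : Set V))ᶜ.ConnectedComponent := by
  classical
  set H := (G.induce (σ : Set V))ᶜ with hH
  have := Fintype.ofFinite H.ConnectedComponent
  let r : (H.ConnectedComponent → K) →ₗ[K] (V → K) := LinearMap.pi fun v =>
    if h : v ∈ σ then LinearMap.proj (H.connectedComponentMk ⟨v, h⟩) else 0
  have hr : ∀ φ v, ∀ h : v ∈ σ, r φ v = φ (H.connectedComponentMk ⟨v, h⟩) := by
    intro φ v h
    simp only [r, LinearMap.pi_apply, dif_pos h, LinearMap.proj_apply]
  obtain ⟨v₀, hv₀⟩ : σ.Nonempty := Finset.card_pos.1 (by omega)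
  have hne : (1 : H.ConnectedComponent → K) ≠ 0 := fun h =>
    one_ne_zero (congrFun h (H.connectedComponentMk ⟨v₀, hv₀⟩))
  have hdim : koszulDim (edgePiece K G) σ (j + 1) =
      quotDim (⊤ : Submodule K (H.ConnectedComponent → K)) (Submodule.span K {1}) := by
    refine quotDim_eq_of_maps (W := ⊤) (strandChain K G σ ∘ₗ r) LinearMap.id ?_ ?_ le_top
      (le_sup_of_le_left (by simp)) ?_
    · rintro _ ⟨φ, -, rfl⟩
      refine ⟨strandChain_mem G (i := j + 1) hσ _, ?_⟩
      refine (koszulD_strandChain_eq_zero_iff G hσ _).2 fun u hu w hw huw => ?_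
      rw [hr _ _ hu, hr _ _ hw]
      by_cases h : u = w
      · subst h
        rfl
      · congr 1
        refine SimpleGraph.ConnectedComponent.eq.2 (SimpleGraph.Adj.reachable ?_)
        simp [hH, h, huw]
    · rintro x ⟨hx, hx'⟩
      obtain ⟨g, rfl⟩ := exists_eq_strandChain (i := j + 1) hσ hx
      have hg := (koszulD_strandChain_eq_zero_iff G hσ g).1 hx'
      have hwalk : ∀ (u w : (σ : Set V)) (p : H.Walk u w), g u = g w := by
        intro u w p
        induction p with
        | nil => rfl
        | @cons u v w h p ih =>
          rw [← ih]
          refine hg u u.2 v v.2 ?_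
          simp only [hH, SimpleGraph.compl_adj, SimpleGraph.comap_adj] at h
          exact h.2
      refine Submodule.mem_sup_left ⟨fun c => c.lift (fun v : (σ : Set V) => g v)
        fun u w p _ => hwalk u w p, trivial, ?_⟩
      refine koszulChain_ext hσ (strandChain_mem G hσ _) (strandChain_mem G hσ _) fun v hv => ?_
      rw [LinearMap.comp_apply, strandChain_erase G _ hv, strandChain_erase G _ hv, hr _ _ hv]
      rfl
    · intro φ _
      rw [LinearMap.comp_apply, strandChain_mem_boundaries_iff G hσ, LinearMap.id_apply,
        Submodule.mem_span_singleton]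
      refine exists_congr fun c => ⟨fun h => ?_, ?_⟩
      · funext C
        induction C using SimpleGraph.ConnectedComponent.ind with
        | h v => 
          have := h v.1 v.2
          rw [hr _ _ v.2] at this
          simpa using this.symm
      · rintro rfl v hv
        rw [hr _ _ hv]
        simp
  rw [hdim, quotDim_top]
  have h := Submodule.finrank_quotient_add_finrank
    (Submodule.span K {(1 : H.ConnectedComponent → K)})
  rw [finrank_span_singleton hne, Module.finrank_fintype_fun_eq_card] at h
  rw [h, Nat.card_eq_fintype_card]

end LinearStrand

/-! ### Spanning complete multipartite subgraphs -/

section Partite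

variable {W : Type*}

/-- A spanning complete `c`-partite subgraph is a surjection from the components of the complement
onto the `c` classes. -/
theorem hasSpanningCompletePartite_iff_surjective (H : SimpleGraph W) (c : ℕ) :
    HasSpanningCompletePartite H c ↔
      ∃ g : Hᶜ.ConnectedComponent → Fin c, Function.Surjective g := by
  constructor
  · rintro ⟨H', hle, f, hf, hadj⟩
    have hwalk : ∀ (u w : W) (p : Hᶜ.Walk u w), f u = f w := by
      intro u w p
      induction p with
      | nil => rfl
      | @cons u v w h p ih =>
        rw [← ih]
        by_contra hne
        exact h.2 (hle ((hadj u v).2 hne))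
    refine ⟨fun C => C.lift f fun u w p _ => hwalk u w p, fun k => ?_⟩
    obtain ⟨w, rfl⟩ := hf k
    exact ⟨Hᶜ.connectedComponentMk w, rfl⟩
  · rintro ⟨g, hg⟩
    let f : W → Fin c := fun w => g (Hᶜ.connectedComponentMk w)
    refine ⟨(⊤ : SimpleGraph (Fin c)).comap f, fun u v h => ?_, f, fun k => ?_, fun u v => ?_⟩
    · by_contra hn
      have hne : f u ≠ f v := h
      have huv : u ≠ v := fun h => hne (congrArg f h)
      refine hne (congrArg g (SimpleGraph.ConnectedComponent.eq.2 (SimpleGraph.Adj.reachable ?_)))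
      exact (SimpleGraph.compl_adj H u v).2 ⟨huv, hn⟩
    · obtain ⟨C, rfl⟩ := hg k
      induction C using SimpleGraph.ConnectedComponent.ind with
      | h w => exact ⟨w, rfl⟩
    · simp

theorem hasSpanningCompletePartite_iff [Finite W] (H : SimpleGraph W) {c : ℕ} (hc : 1 ≤ c) :
    HasSpanningCompletePartite H c ↔ c ≤ Nat.card Hᶜ.ConnectedComponent := by
  rw [hasSpanningCompletePartite_iff_surjective]
  constructor
  · rintro ⟨g, hg⟩
    simpa using Nat.card_le_card_of_surjective g hg
  · intro h
    have : NeZero c := ⟨by omega⟩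
    let e' : Fin c ↪ Hᶜ.ConnectedComponent :=
      (Fin.castLEEmb h).trans (Finite.equivFin _).symm.toEmbedding
    exact ⟨Function.invFun e', Function.invFun_surjective e'.injective⟩

theorem partiteNumber_eq [Finite W] [Nonempty W] (H : SimpleGraph W) :
    partiteNumber H = Nat.card Hᶜ.ConnectedComponent := by
  have hpos : 0 < Nat.card Hᶜ.ConnectedComponent := by
    have : Nonempty Hᶜ.ConnectedComponent := ⟨Hᶜ.connectedComponentMk (Classical.arbitrary W)⟩
    exact Nat.card_pos
  rw [partiteNumber, hasSpanningCompletePartite_iff H one_le_two]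
  split_ifs with h
  · refine IsGreatest.csSup_eq ⟨⟨h, (hasSpanningCompletePartite_iff H hpos).2 le_rfl⟩, ?_⟩
    rintro c ⟨hc, hc'⟩
    exact (hasSpanningCompletePartite_iff H (by omega)).1 hc'
  · omega

end Partite

/-! ### Existence of minimal graded free resolutions -/

section Existence

variable {V K ι : Type*} [Field K]

theorem mem_span_X_iff {p : MvPolynomial V K} :
    p ∈ Ideal.span (Set.range (X : V → MvPolynomial V K)) ↔ coeff 0 p = 0 := by
  refine ⟨coeff_zero_of_mem_span_X, fun h => ?_⟩
  rw [← Set.image_univ, mem_ideal_span_X_image]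
  intro e he
  have he0 : e ≠ 0 := by
    rintro rfl
    exact mem_support_iff.1 he h
  obtain ⟨v, hv⟩ := Finsupp.ne_iff.1 he0
  exact ⟨v, trivial, hv⟩

theorem smul_mem_homPiece {deg : ι → V →₀ ℕ} {δ τ : V →₀ ℕ} {p : MvPolynomial V K}
    (hp : ∀ e ∈ p.support, e + δ = τ) {y : ι →₀ MvPolynomial V K} (hy : y ∈ homPiece K deg δ) :
    p • y ∈ homPiece K deg τ := by
  classical
  intro b e he
  rw [Finsupp.smul_apply, smul_eq_mul] at he
  obtain ⟨e₁, h₁, e₂, h₂, rfl⟩ := Finset.mem_add.1 (support_mul _ _ he)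
  rw [add_assoc, hy b e₂ h₂, hp e₁ h₁]

theorem exists_eq_sum_homProj [Finite ι] (deg : ι → V →₀ ℕ) (x : ι →₀ MvPolynomial V K) :
    ∃ T : Finset (V →₀ ℕ), x = ∑ τ ∈ T, homProj K deg τ x := by
  classical
  have := Fintype.ofFinite ι
  refine ⟨Finset.univ.biUnion fun b => (x b).support.image (· + deg b), ?_⟩
  ext b e
  rw [Finsupp.finsetSum_apply, coeff_sum]
  simp only [coeff_homProj, Finset.sum_ite_eq]
  split_ifs with h
  · rfl
  · by_contra hne
    exact h (Finset.mem_biUnion.2 ⟨b, Finset.mem_univ _,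
      Finset.mem_image_of_mem _ (mem_support_iff.2 hne)⟩)

/-- A family of homogeneous generators of `N`, of the given degrees. -/
structure IsHomogeneousGenerators (deg : ι → V →₀ ℕ)
    (N : Submodule (MvPolynomial V K) (ι →₀ MvPolynomial V K)) {n : ℕ}
    (g : Fin n → ι →₀ MvPolynomial V K) (deg' : Fin n → V →₀ ℕ) : Prop where
  mem_homPiece : ∀ i, g i ∈ homPiece K deg (deg' i)
  span_eq : Submodule.span (MvPolynomial V K) (Set.range g) = N

theorem exists_isHomogeneousGenerators [Finite V] [Finite ι] (deg : ι → V →₀ ℕ)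
    (N : Submodule (MvPolynomial V K) (ι →₀ MvPolynomial V K))
    (hN : ∀ x ∈ N, ∀ τ, homProj K deg τ x ∈ N) :
    ∃ (n : ℕ) (g : Fin n → ι →₀ MvPolynomial V K) (deg' : Fin n → V →₀ ℕ),
      IsHomogeneousGenerators deg N g deg' := by
  have hspan : Submodule.span (MvPolynomial V K) {y | y ∈ N ∧ ∃ τ, y ∈ homPiece K deg τ} = N := by
    refine le_antisymm (Submodule.span_le.2 fun y hy => hy.1) fun x hx => ?_
    obtain ⟨T, hT⟩ := exists_eq_sum_homProj deg x
    rw [hT]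
    exact Submodule.sum_mem _ fun τ _ => Submodule.subset_span ⟨hN x hx τ, τ, homProj_mem deg τ x⟩
  have hfg := IsNoetherian.noetherian N
  rw [← hspan, Submodule.fg_span_iff_fg_span_finset_subset] at hfg
  obtain ⟨s, hs, hs'⟩ := hfg
  have hs'' : ∀ i : s, ∃ τ, (i : ι →₀ MvPolynomial V K) ∈ homPiece K deg τ := fun i => (hs i.2).2
  choose τ hτ using hs''
  refine ⟨s.card, fun i => s.equivFin.symm i, fun i => τ (s.equivFin.symm i), fun i => hτ _, ?_⟩
  rw [← hspan, hs']
  congr 1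
  ext y
  constructor
  · rintro ⟨i, rfl⟩
    exact (s.equivFin.symm i).2
  · intro hy
    exact ⟨s.equivFin ⟨y, hy⟩, by simp⟩

/-- A graded submodule of a graded free module is the image of a homogeneous map from a graded free
module whose kernel lies in `𝔪` times the free module: take a homogeneous generating family of the
least possible size. A relation with a unit coefficient would, in its homogeneous component,
express one generator by the others. -/
theorem exists_minimal_presentation [Finite V] [Finite ι] (deg : ι → V →₀ ℕ)
    (N : Submodule (MvPolynomial V K) (ι →₀ MvPolynomial V K))
    (hN : ∀ x ∈ N, ∀ τ, homProj K deg τ x ∈ N) :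
    ∃ (n : ℕ) (deg' : Fin n → V →₀ ℕ)
      (d : (Fin n →₀ MvPolynomial V K) →ₗ[MvPolynomial V K] (ι →₀ MvPolynomial V K)),
      (∀ τ, ∀ x ∈ homPiece K deg' τ, d x ∈ homPiece K deg τ) ∧ LinearMap.range d = N ∧
      ∀ x, d x = 0 → ∀ b, coeff 0 (x b) = 0 := by
  classical
  have hex := exists_isHomogeneousGenerators deg N hN
  obtain ⟨g, deg', hg⟩ := Nat.find_spec hex
  have hmin := fun m => Nat.find_min hex (m := m)
  generalize Nat.find hex = n at g deg' hg hmin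
  have hhom : ∀ τ, ∀ x ∈ homPiece K deg' τ,
      Finsupp.linearCombination (MvPolynomial V K) g x ∈ homPiece K deg τ := by
    intro τ x hx
    rw [Finsupp.linearCombination_apply, Finsupp.sum]
    exact Submodule.sum_mem _ fun i _ => smul_mem_homPiece (hx i) (hg.mem_homPiece i)
  refine ⟨n, deg', Finsupp.linearCombination _ g, hhom, ?_, fun x hx b => ?_⟩
  · rw [Finsupp.range_linearCombination, hg.span_eq]
  · by_contra hne
    obtain ⟨n, rfl⟩ : ∃ m, n = m + 1 := ⟨n - 1, by have := b.2; omega⟩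
    refine hmin n (Nat.lt_succ_self n) ⟨fun i => g (b.succAbove i), fun i => deg' (b.succAbove i),
      fun i => hg.mem_homPiece _, ?_⟩
    -- The component of degree `deg' b` of the relation `x` has a nonzero constant at `b`.
    have hx' : Finsupp.linearCombination (MvPolynomial V K) g (homProj K deg' (deg' b) x) = 0 := by
      rw [← homProj_map _ hhom, hx, map_zero]
    have hb : homProj K deg' (deg' b) x b = C (coeff 0 (x b)) := by
      ext e
      rw [coeff_homProj, coeff_C]
      by_cases he : e = 0
      · simp [he]
      · rw [if_neg (by simpa using he), if_neg (Ne.symm he)]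
    rw [Finsupp.linearCombination_apply, Finsupp.sum_fintype _ _ (by simp),
      Fin.sum_univ_succAbove _ b, hb] at hx'
    have hgb : g b ∈ Submodule.span (MvPolynomial V K)
        (Set.range fun i => g (b.succAbove i)) := by
      have h₁ : g b = (C (coeff 0 (x b))⁻¹ : MvPolynomial V K) •
          (C (coeff 0 (x b)) : MvPolynomial V K) • g b := by
        rw [smul_smul, ← C_mul, inv_mul_cancel₀ hne, C_1, one_smul]
      rw [h₁, eq_neg_of_add_eq_zero_left hx']
      exact Submodule.smul_mem _ _ (neg_mem (Submodule.sum_mem _ fun i _ =>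
        Submodule.smul_mem _ _ (Submodule.subset_span ⟨i, rfl⟩)))
    rw [← hg.span_eq]
    refine le_antisymm (Submodule.span_mono ?_) (Submodule.span_le.2 ?_)
    · rintro _ ⟨i, rfl⟩
      exact ⟨_, rfl⟩
    · rintro _ ⟨i, rfl⟩
      by_cases hi : i = b
      · rw [hi]
        exact hgb
      · obtain ⟨k, rfl⟩ := Fin.exists_succAbove_eq hi
        exact Submodule.subset_span ⟨k, rfl⟩

/-- A graded submodule of `𝔪 F`, for a graded free module `F`: a syzygy module in a minimal
resolution. -/
structure Syzygy (V K : Type*) [Field K] where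
  /-- the rank of `F` -/
  rank : ℕ
  /-- the degrees of the basis of `F` -/
  deg : Fin rank → V →₀ ℕ
  /-- the submodule -/
  N : Submodule (MvPolynomial V K) (Fin rank →₀ MvPolynomial V K)
  homProj_mem : ∀ x ∈ N, ∀ τ, homProj K deg τ x ∈ N
  coeff_zero : ∀ x ∈ N, ∀ b, coeff 0 (x b) = 0

theorem Syzygy.exists_next [Finite V] (s : Syzygy V K) : ∃ (t : Syzygy V K)
    (d : (Fin t.rank →₀ MvPolynomial V K) →ₗ[MvPolynomial V K]
      (Fin s.rank →₀ MvPolynomial V K)),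
    (∀ τ, ∀ x ∈ homPiece K t.deg τ, d x ∈ homPiece K s.deg τ) ∧ LinearMap.range d = s.N ∧
      LinearMap.ker d = t.N := by
  obtain ⟨n, deg', d, hhom, hrange, hmin⟩ := exists_minimal_presentation s.deg s.N s.homProj_mem
  refine ⟨⟨n, deg', LinearMap.ker d, fun x hx τ => ?_, hmin⟩, d, hhom, hrange, rfl⟩
  rw [LinearMap.mem_ker] at hx ⊢
  rw [← homProj_map d hhom, hx, map_zero]

/-- The resolution is built from the syzygy `I` of `S/I` by repeated minimal presentations. -/
theorem nonempty_minimalFreeResolution [Finite V] {I : Ideal (MvPolynomial V K)}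
    (hI : IsMonomialIdeal I) (hI0 : ∀ p ∈ I, coeff 0 p = 0) :
    Nonempty (MinimalFreeResolution (quotientPiece I)) := by
  classical
  choose next d hd using fun s : Syzygy V K => s.exists_next
  let ε : (Fin 1 →₀ MvPolynomial V K) →ₗ[MvPolynomial V K] (MvPolynomial V K ⧸ I) :=
    I.mkQ ∘ₗ Finsupp.lapply 0
  have hε : ∀ x, ε x = 0 ↔ x 0 ∈ I := fun x => Submodule.Quotient.mk_eq_zero I
  let s₀ : Syzygy V K :=
    { rank := 1
      deg := fun _ => 0
      N := LinearMap.ker ε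
      homProj_mem := by
        intro x hx τ
        have h : homProj K (fun _ : Fin 1 => (0 : V →₀ ℕ)) τ x 0 =
            monomial τ (coeff τ (x 0)) := by
          ext e
          rw [coeff_homProj, coeff_monomial, add_zero]
          by_cases h : e = τ
          · simp [h]
          · rw [if_neg h, if_neg (Ne.symm h)]
        refine (hε _).2 ?_
        rw [h]
        exact hI _ ((hε x).1 hx) τ
      coeff_zero := by
        intro x hx b
        rw [Subsingleton.elim b 0]
        exact hI0 _ ((hε x).1 hx) }
  let s : ℕ → Syzygy V K := fun n => Nat.rec s₀ (fun _ => next) n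
  exact ⟨{
    ι := fun i => Fin (s i).rank
    finite_ι := fun i => inferInstance
    deg := fun i => (s i).deg
    d := fun i => d (s i)
    ε := ε
    d_homogeneous := fun i => (hd (s i)).1
    ε_homogeneous := by
      intro τ x hx
      refine ⟨x 0, Submodule.mem_span_singleton.2 ⟨coeff τ (x 0), ?_⟩, rfl⟩
      ext e
      rw [smul_monomial, smul_eq_mul, mul_one, coeff_monomial]
      split_ifs with h
      · rw [h]
      · refine (coeff_eq_zero_of_mem_homPiece hx ?_).symm
        exact fun h' => h ((add_zero e).symm.trans h').symm
    exact_d := fun i => LinearMap.exact_iff.2 ((hd (s i)).2.2.trans (hd (s (i + 1))).2.1.symm)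
    exact_ε := LinearMap.exact_iff.2 (hd s₀).2.1.symm
    surjective_ε := by
      intro y
      obtain ⟨p, rfl⟩ := Submodule.Quotient.mk_surjective _ y
      exact ⟨Finsupp.single 0 p, by simp [ε]⟩
    minimal := by
      intro i x b
      rw [mem_span_X_iff]
      refine (s i).coeff_zero _ ?_ b
      rw [← (hd (s i)).2.1]
      exact ⟨x, rfl⟩ }⟩

end Existence

/-! ### The Betti numbers of the linear strand -/

theorem coeff_zero_of_mem_edgeIdeal {V K : Type*} [Field K] {G : SimpleGraph V}
    {p : MvPolynomial V K} (hp : p ∈ edgeIdeal K G) : coeff 0 p = 0 := by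
  by_contra h
  obtain ⟨u, v, -, hle⟩ := mem_edgeIdeal_iff.1 hp 0 (mem_support_iff.2 h)
  simpa using hle u

/-- The linear strand: `β_{j+1,σ} + 1` for `|σ| = j + 2` counts the components of the complement of
the induced subgraph. -/
theorem betti_add_one {V K : Type*} [Field K] (G : SimpleGraph V)
    (F : MinimalFreeResolution (quotientPiece (edgeIdeal K G))) {σ : Finset V} {j : ℕ}
    (hσ : σ.card = j + 2) : F.betti (j + 1) (zeroOneVector σ) + 1 =
      Nat.card (G.induce (σ : Set V))ᶜ.ConnectedComponent := by
  -- The signs of the Koszul complex need an ordering of the vertices; any will do.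
  let _ : LinearOrder V := IsWellOrder.linearOrder WellOrderingRel
  rw [← koszulDim_edgePiece (K := K) G hσ,
    ← F.koszulDim_eq_betti (map_ε_homPiece (isMonomialIdeal_edgeIdeal G) F)]
  rfl

end EdgeIdealBetti

end

theorem proposition5p1 {V K : Type*} [Finite V] [Field K] (G : SimpleGraph V)
    (i : ℕ) (hi : 1 ≤ i) (σ : Finset V) (hσ : σ.card = i + 1) :
    Nonempty (EdgeIdealBetti.MinimalFreeResolution
      (EdgeIdealBetti.quotientPiece (EdgeIdealBetti.edgeIdeal K G))) ∧
    ∀ F : EdgeIdealBetti.MinimalFreeResolution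
      (EdgeIdealBetti.quotientPiece (EdgeIdealBetti.edgeIdeal K G)),
      (F.betti i (EdgeIdealBetti.zeroOneVector σ) : ℤ) =
        (EdgeIdealBetti.partiteNumber (G.induce (σ : Set V)) : ℤ) - 1 ∧
      (F.betti i (EdgeIdealBetti.zeroOneVector σ) ≠ 0 ↔
        EdgeIdealBetti.HasSpanningCompletePartite (G.induce (σ : Set V)) 2) := by
  refine ⟨EdgeIdealBetti.nonempty_minimalFreeResolution
    (EdgeIdealBetti.isMonomialIdeal_edgeIdeal G)
    fun _ => EdgeIdealBetti.coeff_zero_of_mem_edgeIdeal, fun F => ?_⟩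
  obtain ⟨j, rfl⟩ : ∃ j, i = j + 1 := ⟨i - 1, by omega⟩
  obtain ⟨v, hv⟩ : σ.Nonempty := Finset.card_pos.1 (by omega)
  have : Nonempty (σ : Set V) := ⟨⟨v, hv⟩⟩
  have h := EdgeIdealBetti.betti_add_one G F hσ
  rw [EdgeIdealBetti.partiteNumber_eq, EdgeIdealBetti.hasSpanningCompletePartite_iff _ one_le_two,
    ← h]
  constructor
  · push_cast
    ring
  · omega
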